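/- Let $k>0$, $R>0$ with $kR\ge 2$, let $B_R=\{x\in\mathbb R^3:|x|<R\}$, and write $x=r\sigma$ with $r=|x|$, $|\sigma|=1$. For every $n\ge 0$ let $(Y_n^m)_m$ be an orthonormal basis (in $L^2$ of the unit sphere $S^2$) of the space of spherical harmonics of degree $n$. For a function $f$ on $S^2$ put $f_{m,n}=\int_{S^2} f\,\overline{Y_n^m}$ and $f_n=\big(\sum_m|f_{m,n}|^2\big)^{1/2}$, and for $l=0,1$ $$\|f\|^2_{(l)}(\partial B_R)=R^2\sum_{m=0}^{l}\sum_{n=0}^\infty\Big(\frac nR\Big)^{2m}f_n^2 .$$ Let $$u_1(x)=\frac{R^2}{(ikR-1)e^{ikR}}\,\frac{e^{ikr}}{r},$$ which solves the hard (Neumann) scattering problem $(\Delta+k^2)u_1=0$ in $\mathbb R^3\setminus\overline{B_R}$, $\partial_r u_1=1$ on $\partial B_R$, with the Sommerfeld radiation condition. Let $d$ be a real function on $S^2$ that belongs to $H^1(S^2)$, i.e. $d\in L^2(S^2)$ and $\sum_n n^2d_n^2<\infty$. Let $v_1$ be a solution of the hard obstacle problem linearized around $B_R$: $v_1$ is $C^2$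 and $(\Delta+k^2)v_1=0$ in $\mathbb R^3\setminus\overline{B_R}$; $r(\partial_r v_1-ikv_1)\to0$ as $r\to\infty$, uniformly in $\sigma$; and $\partial_r v_1=k^2u_1d$ on $\partial B_R$, in the sense that $\partial_rv_1(r\,\cdot)\to k^2u_1(R\,\cdot)\,d$ in $L^2(S^2)$ as $r\downarrow R$. Let $A=A(v_1)$ be its scattering amplitude, i.e. $v_1(x)=\frac{e^{ikr}}rA(\sigma)+O(r^{-2})$ as $r\to\infty$, uniformly in $\sigma$. With $a_n=A_n$ (that is, $f_n$ for $f=A$) and $N=[\sqrt{kR}]$ ($[\cdot]$ the integer part) put $$\varepsilon_1=\Big(\sum_{n=0}^Na_n^2\Big)^{1/2},\qquad \varepsilon_2=\Big(\sum_{n=N+1}^\infty a_n^2\Big)^{1/2},\qquad E=-\log\varepsilon_2 .$$ **Corollary 4.2.** Assume $\varepsilon_2\le1$. If $\varepsilon_2>0$ and $E+k\ne1$, then $$\|d\|^2_{(0)}(\partial B_R)\le\frac{k^2R^2+1}{k^2R^2}\Big(\frac{e^2}{\pi}(3+\sqrt5)\,\varepsilon_1^2+e^{2/R}\varepsilon_2\Big)+\frac{R^2\,\|d\|^2_{(1)}(\partial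 B_R)}{E+k-2\sqrt{E+k}+1}.$$ If $\varepsilon_2=0$ (so that $E=+\infty$), the same estimate holds with the last two terms absent: $$\|d\|^2_{(0)}(\partial B_R)\le\frac{k^2R^2+1}{k^2R^2}\cdot\frac{e^2}{\pi}(3+\sqrt5)\,\varepsilon_1^2 .$$ -/

import Mathlib

open MeasureTheory Filter Topology

noncomputable section

namespace HardObstacle

/-- The Euclidean space `ℝ³`. -/
abbrev E3 : Type := EuclideanSpace ℝ (Fin 3)

/-- The unit sphere of `ℝ³`. -/
abbrev S2 : Type := Metric.sphere (0 : E3) 1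

/-- The surface measure of the unit sphere (total mass `4π`). -/
def surf : Measure S2 := (volume : Measure E3).toSphere

/-! ### Spherical harmonics and Sobolev norms on spheres -/

/-- `P` is a solid harmonic of degree `n`: a homogeneous polynomial of degree `n` in three variables
with `∑ᵢ ∂ᵢ² P = 0`. -/
def IsSolidHarmonic (n : ℕ) (P : MvPolynomial (Fin 3) ℂ) : Prop :=
  P.IsHomogeneous n ∧ ∑ i : Fin 3, MvPolynomial.pderiv i (MvPolynomial.pderiv i P) = 0

/-- The value at a point of the unit sphere of a polynomial in three variables. -/
def restrict (P : MvPolynomial (Fin 3) ℂ) (σ : S2) : ℂ :=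
  MvPolynomial.eval (fun i => (((σ : E3) i : ℝ) : ℂ)) P

/-- The space of spherical harmonics of degree `n`, as a subspace of `L²(S²)`: the restrictions to
the unit sphere of the solid harmonics of degree `n`. -/
def harmonics (n : ℕ) : Submodule ℂ (Lp ℂ 2 surf) where
  carrier := {f | ∃ P, IsSolidHarmonic n P ∧ f =ᵐ[surf] restrict P}
  zero_mem' := by
    refine ⟨0, ⟨MvPolynomial.isHomogeneous_zero _ _ _, by simp⟩, ?_⟩
    filter_upwards [Lp.coeFn_zero ℂ 2 surf] with σ h
    exact h.trans (by simp [restrict])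
  add_mem' := by
    rintro f g ⟨P, ⟨hP, hP'⟩, hf⟩ ⟨Q, ⟨hQ, hQ'⟩, hg⟩
    refine ⟨P + Q, ⟨hP.add hQ, by simp [Finset.sum_add_distrib, hP', hQ']⟩, ?_⟩
    filter_upwards [Lp.coeFn_add f g, hf, hg] with σ h h1 h2
    exact h.trans (by rw [Pi.add_apply, h1, h2]; simp [restrict])
  smul_mem' := by
    rintro c f ⟨P, ⟨hP, hP'⟩, hf⟩
    refine ⟨MvPolynomial.C c * P, ⟨?_, ?_⟩, ?_⟩
    · simpa using (MvPolynomial.isHomogeneous_C (Fin 3) c).mul hP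
    · simp [← Finset.mul_sum, hP']
    · filter_upwards [Lp.coeFn_smul c f, hf] with σ h h1
      exact h.trans (by rw [Pi.smul_apply, h1]; simp [restrict])

/-- A choice, for every degree `n`, of an orthonormal basis `Yₙᵐ` of the spherical harmonics of
degree `n`.  (The index type `ι n` then has `2 n + 1` elements; the quantities `coeffSq` below do
not depend on the choice.) -/
abbrev HarmonicBasis (ι : ℕ → Type*) [∀ n, Fintype (ι n)] : Type _ :=
  ∀ n, OrthonormalBasis (ι n) ℂ (harmonics n)

section Expansion

variable {ι : ℕ → Type*} [∀ n, Fintype (ι n)]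

/-- The coefficient `∫ f conj(Yₙᵐ)` over the unit sphere of the expansion of `f` with respect to
the `Yₙᵐ`. -/
def coeff (Y : HarmonicBasis ι) (f : S2 → ℂ) (n : ℕ) (m : ι n) : ℂ :=
  ∫ σ, f σ * starRingEnd ℂ ((Y n m : Lp ℂ 2 surf) σ) ∂surf

/-- `aₙ² = ∑ₘ |aₘₙ|²`, the squared size of the degree `n` part of `f`. -/
def coeffSq (Y : HarmonicBasis ι) (f : S2 → ℂ) (n : ℕ) : ℝ :=
  ∑ m, ‖coeff Y f n m‖ ^ 2

/-- The squared norm `‖f‖²₍ₗ₎(∂B_R) = R² ∑_{m ≤ l} ∑ₙ (n / R)²ᵐ fₙ²` of the function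
`R σ ↦ f σ` on the sphere of radius `R` (meaningful when the series converge). -/
def sobolevSq (Y : HarmonicBasis ι) (R : ℝ) (l : ℕ) (f : S2 → ℂ) : ℝ :=
  R ^ 2 * ∑ m ∈ Finset.range (l + 1), ∑' n : ℕ, ((n : ℝ) / R) ^ (2 * m) * coeffSq Y f n

/-- `f` belongs to the Sobolev space `H¹` of the sphere: it is in `L²` and the series of `‖f‖₍₁₎`
converges. -/
def MemH1 (Y : HarmonicBasis ι) (f : S2 → ℂ) : Prop :=
  MemLp f 2 surf ∧ Summable fun n : ℕ => (n : ℝ) ^ 2 * coeffSq Y f n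

/-- The cut-off degree `N = [√(k R)]`. -/
def cutoff (k R : ℝ) : ℕ := ⌊√(k * R)⌋₊

/-- `ε₁² = ∑_{n ≤ N} aₙ²`; this is `ε₁`. -/
def eps1 (Y : HarmonicBasis ι) (k R : ℝ) (A : S2 → ℂ) : ℝ :=
  √(∑ n ∈ Finset.range (cutoff k R + 1), coeffSq Y A n)

/-- `ε₂² = ∑_{n ≥ N + 1} aₙ²`; this is `ε₂`. -/
def eps2 (Y : HarmonicBasis ι) (k R : ℝ) (A : S2 → ℂ) : ℝ :=
  √(∑' n : ℕ, coeffSq Y A (cutoff k R + 1 + n))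

end Expansion

/-! ### The scattering problem -/

/-- The radial derivative `∂ᵣ v` at the point `r σ`. -/
def radialDeriv (v : E3 → ℂ) (r : ℝ) (σ : S2) : ℂ :=
  deriv (fun s : ℝ => v (s • (σ : E3))) r

/-- `v` is a (classical) solution of `(Δ + k²) v = 0` outside the closed ball of radius `R`. -/
def SolvesHelmholtz (k R : ℝ) (v : E3 → ℂ) : Prop :=
  ContDiffOn ℝ 2 v {x | R < ‖x‖} ∧
    ∀ x, R < ‖x‖ → Laplacian.laplacian v x + (k : ℂ) ^ 2 * v x = 0

/-- The Sommerfeld radiation condition `r (∂ᵣ v - i k v) → 0`, uniformly in all directions. -/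
def Radiating (k : ℝ) (v : E3 → ℂ) : Prop :=
  TendstoUniformly
    (fun (r : ℝ) (σ : S2) =>
      (r : ℂ) * (radialDeriv v r σ - Complex.I * k * v (r • (σ : E3))))
    (fun _ => 0) atTop

/-- `A` is the scattering amplitude of `v`: `v(x) = r⁻¹ e^{ikr} A(σ) + O(r⁻²)` as
`r = |x| → ∞`, uniformly in `σ = x / r`. -/
def IsScatteringAmplitude (k : ℝ) (v : E3 → ℂ) (A : S2 → ℂ) : Prop :=
  ∃ C r₀ : ℝ, ∀ r : ℝ, r₀ ≤ r → 0 < r → ∀ σ : S2,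
    ‖v (r • (σ : E3)) - Complex.exp (Complex.I * k * r) / r * A σ‖ ≤ C / r ^ 2

/-- The solution `u₁ = R² ((ikR - 1) e^{ikR})⁻¹ e^{ikr} / r` of the scattering problem for the hard
ball of radius `R`, that is, the radiating solution with `∂ᵣ u₁ = 1` on the sphere of radius
`R`. -/
def hardWave (k R : ℝ) (x : E3) : ℂ :=
  (R : ℂ) ^ 2 / ((Complex.I * k * R - 1) * Complex.exp (Complex.I * k * R)) *
    (Complex.exp (Complex.I * k * (‖x‖ : ℝ)) / (‖x‖ : ℝ))

/-- The Neumann condition `∂ᵣ v = g` on the sphere of radius `R`, for `g` given as a function of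
the direction; the boundary values are taken in `L²(S²)`, as limits from outside (this includes the
case of a `v` whose gradient is continuous up to the sphere). -/
def NeumannData (R : ℝ) (v : E3 → ℂ) (g : S2 → ℂ) : Prop :=
  Tendsto (fun r : ℝ => eLpNorm (fun σ => radialDeriv v r σ - g σ) 2 surf) (𝓝[>] R) (𝓝 0)

/-- `v` solves the hard obstacle scattering problem linearized around the ball of radius `R`, for
the perturbation `d` of the ball: `v` is a radiating solution of the Helmholtz equation outside
the ball, and `∂ᵣ v = k² u₁ d` on its boundary. -/
structure SolvesLinearizedHard (k R : ℝ) (d : S2 → ℝ) (v : E3 → ℂ) : Prop where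
  helmholtz : SolvesHelmholtz k R v
  radiating : Radiating k v
  neumann : NeumannData R v fun σ => (k : ℂ) ^ 2 * hardWave k R (R • (σ : E3)) * (d σ : ℂ)

end HardObstacle

end

open MeasureTheory Filter Topology

noncomputable section

namespace HardObstacle

instance : IsFiniteMeasure surf := by unfold surf; infer_instance

theorem integral_eq_integral_sphere {f : E3 → ℂ} (hf : Integrable f) :
    ∫ x, f x = ∫ r in Set.Ioi (0 : ℝ), ((r ^ 2 : ℝ) : ℂ) * ∫ σ, f (r • (σ : E3)) ∂surf := by
  have hmp := (volume : Measure E3).measurePreserving_homeomorphUnitSphereProd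
  have hemb := Homeomorph.measurableEmbedding (homeomorphUnitSphereProd E3)
  have hdim : Module.finrank ℝ E3 - 1 = 2 := by simp
  rw [hdim] at hmp
  have key : ∀ x : ({(0 : E3)}ᶜ : Set E3),
      f x = (fun p : S2 × Set.Ioi (0 : ℝ) => f ((p.2 : ℝ) • (p.1 : E3)))
        (homeomorphUnitSphereProd E3 x) := by
    intro x
    have hx : ‖(x : E3)‖ ≠ 0 := norm_ne_zero_iff.2 x.2
    simp [smul_smul, hx]
  have hint : Integrable (fun p : S2 × Set.Ioi (0 : ℝ) => f ((p.2 : ℝ) • (p.1 : E3)))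
      (surf.prod (Measure.volumeIoiPow 2)) := by
    refine (hmp.integrable_comp_emb hemb).1 ?_
    have h1 : Integrable (fun x : ({(0 : E3)}ᶜ : Set E3) => f x)
        ((volume : Measure E3).comap Subtype.val) :=
      (integrableOn_iff_comap_subtypeVal (measurableSet_singleton _).compl).1 hf.integrableOn
    exact h1.congr (Eventually.of_forall key)
  calc ∫ x, f x = ∫ x : ({(0 : E3)}ᶜ : Set E3), f x ∂((volume : Measure E3).comap (↑)) := by
        rw [integral_subtype_comap (measurableSet_singleton _).compl f, restrict_compl_singleton]
    _ = ∫ p : S2 × Set.Ioi (0 : ℝ), f ((p.2 : ℝ) • (p.1 : E3))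
          ∂(surf.prod (Measure.volumeIoiPow 2)) := by
        refine Eq.trans ?_ (hmp.integral_comp hemb _)
        exact integral_congr_ae (Eventually.of_forall key)
    _ = ∫ r : Set.Ioi (0 : ℝ), ∫ σ, f ((r : ℝ) • (σ : E3)) ∂surf ∂(Measure.volumeIoiPow 2) :=
        integral_prod_symm _ hint
    _ = _ := by
        simp only [Measure.volumeIoiPow, ENNReal.ofReal]
        rw [integral_withDensity_eq_integral_smul
            ((measurable_subtype_coe.pow_const _).real_toNNReal),
          integral_subtype_comap measurableSet_Ioi fun a : ℝ ↦
            Real.toNNReal (a ^ 2) • ∫ σ, f (a • (σ : E3)) ∂surf]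
        refine setIntegral_congr_fun measurableSet_Ioi fun x hx ↦ ?_
        rw [NNReal.smul_def, Real.coe_toNNReal _ (pow_nonneg (le_of_lt hx) _)]
        simp

theorem integral_fderiv_eq_zero {F : E3 → ℂ} (hF : ContDiff ℝ 1 F) (hc : HasCompactSupport F)
    (e : E3) : ∫ x, fderiv ℝ F x e = 0 := by
  have hd : Continuous fun x => fderiv ℝ F x e := (hF.continuous_fderiv one_ne_zero).clm_apply
    continuous_const
  have hi : Integrable fun x => fderiv ℝ F x e :=
    hd.integrable_of_hasCompactSupport (hc.fderiv_apply ℝ e)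
  have := integral_mul_fderiv_eq_neg_fderiv_mul_of_integrable (μ := (volume : Measure E3))
    (f := fun _ : E3 => (1 : ℂ)) (g := F) (v := e) (𝕜 := ℂ) (by simp) (by simpa using hi)
    (by simpa using hF.continuous.integrable_of_hasCompactSupport hc) (by simp)
    (fun x _ => (hF.differentiable one_ne_zero) x)
  simpa using this

/-- The polynomial function on `ℝ³` of a polynomial in three variables. -/
def polyEval (P : MvPolynomial (Fin 3) ℂ) (x : E3) : ℂ :=
  MvPolynomial.eval (fun i => ((x i : ℝ) : ℂ)) P

theorem restrict_eq (P : MvPolynomial (Fin 3) ℂ) (σ : S2) : restrict P σ = polyEval P σ := rfl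

/-- The coordinate `xᵢ` as a complex valued real linear functional. -/
def coordC (i : Fin 3) : E3 →L[ℝ] ℂ :=
  Complex.ofRealCLM.comp (EuclideanSpace.proj i)

@[simp] theorem coordC_apply (i : Fin 3) (x : E3) : coordC i x = ((x i : ℝ) : ℂ) := rfl

theorem hasFDerivAt_polyEval (P : MvPolynomial (Fin 3) ℂ) (x : E3) :
    HasFDerivAt (polyEval P) (∑ i, polyEval (MvPolynomial.pderiv i P) x • coordC i) x := by
  induction P using MvPolynomial.induction_on with
  | C a =>
    have h : polyEval (MvPolynomial.C a) = fun _ => a := by ext x; simp [polyEval]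
    rw [h]
    refine (hasFDerivAt_const a x).congr_fderiv ?_
    ext y
    simp [polyEval]
  | add p q hp hq =>
    have h : polyEval (p + q) = fun x => polyEval p x + polyEval q x := by ext x; simp [polyEval]
    rw [h]
    refine (hp.add hq).congr_fderiv ?_
    ext y
    simp [polyEval, add_mul, Finset.sum_add_distrib]
  | mul_X p j hp =>
    have h : polyEval (p * MvPolynomial.X j) = fun x => polyEval p x * coordC j x := by
      ext x; simp [polyEval]
    rw [h]
    refine (hp.mul (coordC j).hasFDerivAt).congr_fderiv ?_
    ext y
    simp [polyEval, MvPolynomial.pderiv_X, Pi.single_apply, add_mul, Finset.sum_add_distrib]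
    rw [Finset.mul_sum]
    congr 1
    · rw [Finset.sum_eq_single j (by intro b _ hb; simp [hb.symm]) (by simp)]
      simp [mul_comm]
    · exact Finset.sum_congr rfl fun i _ => by ring

theorem contDiff_polyEval (P : MvPolynomial (Fin 3) ℂ) {m : WithTop ℕ∞} :
    ContDiff ℝ m (polyEval P) := by
  induction P using MvPolynomial.induction_on with
  | C a =>
    have h : polyEval (MvPolynomial.C a) = fun _ => a := by ext x; simp [polyEval]
    rw [h]; exact contDiff_const
  | add p q hp hq =>
    have h : polyEval (p + q) = fun x => polyEval p x + polyEval q x := by ext x; simp [polyEval]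
    rw [h]; exact hp.add hq
  | mul_X p j hp =>
    have h : polyEval (p * MvPolynomial.X j) = fun x => polyEval p x * coordC j x := by
      ext x; simp [polyEval]
    rw [h]; exact hp.mul (coordC j).contDiff

theorem fderiv_polyEval_single (P : MvPolynomial (Fin 3) ℂ) (x : E3) (i : Fin 3) :
    fderiv ℝ (polyEval P) x (EuclideanSpace.single i 1) =
      polyEval (MvPolynomial.pderiv i P) x := by
  rw [(hasFDerivAt_polyEval P x).fderiv]
  simp [apply_ite Complex.ofReal]

theorem polyEval_smul {P : MvPolynomial (Fin 3) ℂ} {n : ℕ} (hP : P.IsHomogeneous n) (r : ℝ)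
    (x : E3) : polyEval P (r • x) = (r : ℂ) ^ n * polyEval P x := by
  simp only [polyEval, MvPolynomial.eval_eq', Finset.mul_sum]
  refine Finset.sum_congr rfl fun d hd => ?_
  have hn : ∑ i, d i = n := by
    rw [← hP (MvPolynomial.mem_support_iff.1 hd), Finsupp.weight_apply,
      Finsupp.sum_fintype _ _ (by simp)]
    simp
  simp only [PiLp.smul_apply, smul_eq_mul, Complex.ofReal_mul, mul_pow, Finset.prod_mul_distrib,
    Finset.prod_pow_eq_pow_sum, hn]
  ring

theorem sum_coord_mul_polyEval_pderiv {P : MvPolynomial (Fin 3) ℂ} {n : ℕ}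
    (hP : P.IsHomogeneous n) (x : E3) :
    ∑ i, ((x i : ℝ) : ℂ) * polyEval (MvPolynomial.pderiv i P) x = n * polyEval P x := by
  have := congrArg (MvPolynomial.eval (fun i => ((x i : ℝ) : ℂ))) hP.sum_X_mul_pderiv
  simpa [polyEval] using this

theorem sum_polyEval_pderiv_pderiv {P : MvPolynomial (Fin 3) ℂ} {n : ℕ}
    (hP : IsSolidHarmonic n P) (x : E3) :
    ∑ i, polyEval (MvPolynomial.pderiv i (MvPolynomial.pderiv i P)) x = 0 := by
  have := congrArg (MvPolynomial.eval (fun i => ((x i : ℝ) : ℂ))) hP.2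
  simpa [polyEval] using this

/-- The exterior of the closed ball of radius `R`. -/
def exterior (R : ℝ) : Set E3 := {x | R < ‖x‖}

theorem isOpen_exterior (R : ℝ) : IsOpen (exterior R) := isOpen_lt continuous_const continuous_norm

theorem ne_zero_of_mem_exterior {R : ℝ} (hR : 0 ≤ R) {x : E3} (hx : x ∈ exterior R) : x ≠ 0 := by
  rintro rfl
  simp [exterior] at hx
  linarith

/-- The `i`-th coordinate vector. -/
def basisVec (i : Fin 3) : E3 := EuclideanSpace.single i 1

theorem laplacian_eq_sum_fderiv {v : E3 → ℂ} {x : E3} (hv : ContDiffAt ℝ 2 v x) :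
    Laplacian.laplacian v x =
      ∑ i, fderiv ℝ (fun y => fderiv ℝ v y (basisVec i)) x (basisVec i) := by
  rw [InnerProductSpace.laplacian_eq_iteratedFDeriv_orthonormalBasis v
    (EuclideanSpace.basisFun (Fin 3) ℝ)]
  refine Finset.sum_congr rfl fun i _ => ?_
  have hd : DifferentiableAt ℝ (fderiv ℝ v) x :=
    (hv.fderiv_right (m := 1) le_rfl).differentiableAt one_ne_zero
  rw [iteratedFDeriv_two_apply, fderiv_clm_apply hd (differentiableAt_const _)]
  simp [basisVec]

/-- A radial cut-off of the vector field `p ∇v - v ∇p`, in coordinates. -/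
def greenField (φ : ℝ → ℝ) (v p : E3 → ℂ) (i : Fin 3) (x : E3) : ℂ :=
  (φ ‖x‖ : ℂ) * (p x * fderiv ℝ v x (basisVec i) - v x * fderiv ℝ p x (basisVec i))

theorem norm_mem_tsupport {φ : ℝ → ℝ} {f : E3 → ℂ} (hf : ∀ x, φ ‖x‖ = 0 → f x = 0) {x : E3}
    (hx : x ∈ tsupport f) : ‖x‖ ∈ tsupport φ := by
  have hcl : IsClosed ((fun x : E3 => ‖x‖) ⁻¹' tsupport φ) :=
    (isClosed_tsupport φ).preimage continuous_norm
  refine closure_minimal (fun y hy => ?_) hcl hx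
  exact subset_tsupport φ fun h => hy (hf y h)

theorem hasCompactSupport_of_radial {φ : ℝ → ℝ} (hφ : HasCompactSupport φ) {f : E3 → ℂ}
    (hf : ∀ x, φ ‖x‖ = 0 → f x = 0) : HasCompactSupport f := by
  obtain ⟨M, hM⟩ := hφ.isCompact.isBounded.subset_closedBall 0
  refine HasCompactSupport.of_support_subset_isCompact (isCompact_closedBall (0 : E3) M) ?_
  intro x hx
  have := hM (norm_mem_tsupport hf (subset_tsupport f hx))
  simpa using this

theorem contDiff_greenField {R : ℝ} (hR : 0 ≤ R) {φ : ℝ → ℝ} (hφ : ContDiff ℝ 1 φ)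
    (hs : tsupport φ ⊆ Set.Ioi R) {v p : E3 → ℂ} (hv : ContDiffOn ℝ 2 v (exterior R))
    (hp : ContDiff ℝ 2 p) (i : Fin 3) : ContDiff ℝ 1 (greenField φ v p i) := by
  refine contDiff_iff_contDiffAt.2 fun x => ?_
  by_cases hx : x ∈ tsupport (greenField φ v p i)
  swap
  · exact contDiffAt_const.congr_of_eventuallyEq (notMem_tsupport_iff_eventuallyEq.1 hx)
  have hxR : x ∈ exterior R := hs (norm_mem_tsupport (φ := φ) (by
    intro y hy; simp [greenField, hy]) hx)
  have hx0 := ne_zero_of_mem_exterior hR hxR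
  have hvx : ContDiffAt ℝ 2 v x := hv.contDiffAt ((isOpen_exterior R).mem_nhds hxR)
  have h1 : ContDiffAt ℝ 1 (fun y : E3 => (φ ‖y‖ : ℂ)) x :=
    Complex.ofRealCLM.contDiff.contDiffAt.comp x
      (hφ.contDiffAt.comp x (contDiffAt_norm ℝ hx0))
  have h2 : ContDiffAt ℝ 1 (fun y => fderiv ℝ v y (basisVec i)) x :=
    (hvx.fderiv_right (m := 1) le_rfl).clm_apply contDiffAt_const
  have h3 : ContDiffAt ℝ 1 (fun y => fderiv ℝ p y (basisVec i)) x :=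
    (hp.contDiffAt.fderiv_right (m := 1) le_rfl).clm_apply contDiffAt_const
  exact h1.mul (((hp.of_le one_le_two).contDiffAt.mul h2).sub
    ((hvx.of_le one_le_two).mul h3))

theorem fderiv_ofReal_norm {φ : ℝ → ℝ} {x : E3} (hφ : DifferentiableAt ℝ φ ‖x‖) (hx : x ≠ 0) :
    HasFDerivAt (fun y : E3 => (φ ‖y‖ : ℂ))
      (((deriv φ ‖x‖) * ‖x‖⁻¹) • (Complex.ofRealCLM.comp (innerSL ℝ x))) x := by
  have h1 : HasFDerivAt (fun y : E3 => ‖y‖) (‖x‖⁻¹ • innerSL ℝ x) x := by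
    have h := (hasStrictFDerivAt_norm_sq x).hasFDerivAt.sqrt (by simpa using hx)
    simp only [Real.sqrt_sq (norm_nonneg _)] at h
    refine h.congr_fderiv ?_
    ext y
    simp
    field_simp
  have h2 := hφ.hasDerivAt.comp_hasFDerivAt x h1
  refine (Complex.ofRealCLM.hasFDerivAt.comp x h2).congr_fderiv ?_
  ext y
  simp [mul_assoc]

theorem sum_coord_smul_basisVec (x : E3) : ∑ i, x i • basisVec i = x := by
  have := (EuclideanSpace.basisFun (Fin 3) ℝ).sum_repr x
  simpa [basisVec] using this

theorem sum_coord_mul_map (L : E3 →L[ℝ] ℂ) (x : E3) :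
    ∑ i, ((x i : ℝ) : ℂ) * L (basisVec i) = L x := by
  conv_rhs => rw [← sum_coord_smul_basisVec x]
  simp

theorem sum_fderiv_greenField {k R : ℝ} (hR : 0 ≤ R) {φ : ℝ → ℝ} (hφ : ContDiff ℝ 1 φ)
    {v : E3 → ℂ} (hv : SolvesHelmholtz k R v)
    {n : ℕ} {P : MvPolynomial (Fin 3) ℂ} (hP : IsSolidHarmonic n P) {x : E3}
    (hx : x ∈ exterior R) :
    ∑ i, fderiv ℝ (greenField φ v (polyEval P) i) x (basisVec i) =
      ((deriv φ ‖x‖ : ℝ) : ℂ) * (‖x‖ : ℂ)⁻¹ * (polyEval P x * fderiv ℝ v x x - n * v x * polyEval P x) -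
        (k : ℂ) ^ 2 * φ ‖x‖ * (polyEval P x * v x) := by
  have hx0 := ne_zero_of_mem_exterior hR hx
  have hvx : ContDiffAt ℝ 2 v x := hv.1.contDiffAt ((isOpen_exterior R).mem_nhds hx)
  have key : ∀ i, fderiv ℝ (greenField φ v (polyEval P) i) x (basisVec i) =
      ((deriv φ ‖x‖ : ℝ) : ℂ) * (‖x‖ : ℂ)⁻¹ * (polyEval P x * (((x i : ℝ) : ℂ) *
          fderiv ℝ v x (basisVec i)) -
        v x * (((x i : ℝ) : ℂ) * polyEval (MvPolynomial.pderiv i P) x)) +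
      (φ ‖x‖ : ℂ) * (polyEval P x * fderiv ℝ (fun y => fderiv ℝ v y (basisVec i)) x (basisVec i) -
        v x * polyEval (MvPolynomial.pderiv i (MvPolynomial.pderiv i P)) x) := by
    intro i
    have h1 := fderiv_ofReal_norm (hφ.differentiable one_ne_zero ‖x‖) hx0
    have h2 : DifferentiableAt ℝ (fun y => fderiv ℝ v y (basisVec i)) x :=
      ((hvx.fderiv_right (m := 1) le_rfl).clm_apply contDiffAt_const).differentiableAt one_ne_zero
    have hvd := (hvx.differentiableAt two_ne_zero).hasFDerivAt
    have hpp : (fun y => fderiv ℝ (polyEval P) y (basisVec i)) =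
        polyEval (MvPolynomial.pderiv i P) := by
      ext y; exact fderiv_polyEval_single P y i
    have hF : greenField φ v (polyEval P) i = fun y => (φ ‖y‖ : ℂ) *
        (polyEval P y * fderiv ℝ v y (basisVec i) - v y * polyEval (MvPolynomial.pderiv i P) y) := by
      ext y; simp only [greenField, ← hpp]
    have hd := h1.mul (((hasFDerivAt_polyEval P x).differentiableAt.hasFDerivAt.mul
      h2.hasFDerivAt).sub (hvd.mul
        (hasFDerivAt_polyEval (MvPolynomial.pderiv i P) x).differentiableAt.hasFDerivAt))
    have e1 := fderiv_polyEval_single P x i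
    have e2 := fderiv_polyEval_single (MvPolynomial.pderiv i P) x i
    rw [hF]
    erw [hd.fderiv]
    change fderiv ℝ (polyEval P) x (basisVec i) = _ at e1
    change fderiv ℝ (polyEval (MvPolynomial.pderiv i P)) x (basisVec i) = _ at e2
    have e3 : inner ℝ x (basisVec i) = x i := by
      simpa [basisVec] using EuclideanSpace.inner_single_right (𝕜 := ℝ) i (1 : ℝ) x
    simp [e1, e2, e3]
    ring
  rw [Finset.sum_congr rfl fun i _ => key i, Finset.sum_add_distrib, ← Finset.mul_sum,
    ← Finset.mul_sum, Finset.sum_sub_distrib, Finset.sum_sub_distrib, ← Finset.mul_sum,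
    ← Finset.mul_sum, ← Finset.mul_sum, ← Finset.mul_sum, sum_coord_mul_map,
    sum_coord_mul_polyEval_pderiv hP.1, sum_polyEval_pderiv_pderiv hP,
    ← laplacian_eq_sum_fderiv hvx, eq_neg_of_add_eq_zero_left (hv.2 x hx)]
  ring

theorem exists_bound_near {R : ℝ} {F : ℝ → S2 → ℂ}
    (hF : ContinuousOn (Function.uncurry F) (Set.Ioi R ×ˢ Set.univ)) {r : ℝ} (hr : R < r) :
    ∃ C, ∀ s ∈ Metric.ball r ((r - R) / 2), ∀ σ, ‖F s σ‖ ≤ C := by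
  have hsub : Metric.closedBall r ((r - R) / 2) ×ˢ (Set.univ : Set S2) ⊆
      Set.Ioi R ×ˢ Set.univ := by
    refine Set.prod_mono (fun s hs => ?_) le_rfl
    rw [Metric.mem_closedBall, Real.dist_eq, abs_le] at hs
    exact Set.mem_Ioi.2 (by linarith [hs.1])
  obtain ⟨C, hC⟩ := ((isCompact_closedBall r ((r - R) / 2)).prod isCompact_univ)
    |>.exists_bound_of_continuousOn (hF.mono hsub)
  exact ⟨C, fun s hs σ => hC (s, σ) ⟨Metric.ball_subset_closedBall hs, trivial⟩⟩

theorem continuous_slice {R : ℝ} {F : ℝ → S2 → ℂ}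
    (hF : ContinuousOn (Function.uncurry F) (Set.Ioi R ×ˢ Set.univ)) {r : ℝ} (hr : R < r) :
    Continuous (F r) := by
  refine continuousOn_univ.1 ?_
  exact hF.comp (f := fun σ => (r, σ)) (by fun_prop) fun σ _ => ⟨hr, trivial⟩

theorem integrable_of_continuous {f : S2 → ℂ} (hf : Continuous f) : Integrable f surf :=
  hf.integrable_of_hasCompactSupport (HasCompactSupport.of_compactSpace f)

theorem continuousOn_integral_sphere {R : ℝ} {F : ℝ → S2 → ℂ}
    (hF : ContinuousOn (Function.uncurry F) (Set.Ioi R ×ˢ Set.univ)) :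
    ContinuousOn (fun r => ∫ σ, F r σ ∂surf) (Set.Ioi R) := by
  intro r hr
  refine ContinuousAt.continuousWithinAt ?_
  obtain ⟨C, hC⟩ := exists_bound_near hF hr
  have hpos : 0 < (r - R) / 2 := by linarith [Set.mem_Ioi.1 hr]
  refine continuousAt_of_dominated (bound := fun _ => C) ?_ ?_ (integrable_const C) ?_
  · filter_upwards [Ioi_mem_nhds hr] with s hs
    exact (continuous_slice hF hs).aestronglyMeasurable
  · filter_upwards [Metric.ball_mem_nhds r hpos] with s hs
    exact Eventually.of_forall (hC s hs)
  · refine Eventually.of_forall fun σ => ?_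
    have h := hF.continuousAt (x := (r, σ)) (prod_mem_nhds (Ioi_mem_nhds hr) univ_mem)
    exact h.comp (f := fun s => (s, σ)) (by fun_prop)

theorem hasDerivAt_integral_sphere {R : ℝ} {F F' : ℝ → S2 → ℂ}
    (hF : ContinuousOn (Function.uncurry F) (Set.Ioi R ×ˢ Set.univ))
    (hF' : ContinuousOn (Function.uncurry F') (Set.Ioi R ×ˢ Set.univ))
    (hd : ∀ s, R < s → ∀ σ, HasDerivAt (fun t => F t σ) (F' s σ) s) {r : ℝ} (hr : R < r) :
    HasDerivAt (fun s => ∫ σ, F s σ ∂surf) (∫ σ, F' r σ ∂surf) r := by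
  obtain ⟨C, hC⟩ := exists_bound_near hF' hr
  have hpos : 0 < (r - R) / 2 := by linarith
  refine (hasDerivAt_integral_of_dominated_loc_of_deriv_le (bound := fun _ => C)
    (Metric.ball_mem_nhds r hpos) ?_ (integrable_of_continuous (continuous_slice hF hr))
    (continuous_slice hF' hr).aestronglyMeasurable
    (Eventually.of_forall fun σ s hs => hC s hs σ) (integrable_const C)
    (Eventually.of_forall fun σ s hs => hd s ?_ σ)).2
  · filter_upwards [Ioi_mem_nhds hr] with s hs
    exact (continuous_slice hF hs).aestronglyMeasurable
  · rw [Metric.mem_ball, Real.dist_eq, abs_lt] at hs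
    linarith [hs.1]

/-- The moment of `v(r ·)` against the polynomial `P` on the unit sphere. -/
def moment (v : E3 → ℂ) (P : MvPolynomial (Fin 3) ℂ) (r : ℝ) : ℂ :=
  ∫ σ, v (r • (σ : E3)) * polyEval P σ ∂surf

/-- The moment of the radial derivative of `v` against the polynomial `P` on the unit sphere. -/
def momentDeriv (v : E3 → ℂ) (P : MvPolynomial (Fin 3) ℂ) (r : ℝ) : ℂ :=
  ∫ σ, radialDeriv v r σ * polyEval P σ ∂surf

theorem norm_smul_sphere {r : ℝ} (hr : 0 ≤ r) (σ : S2) : ‖r • (σ : E3)‖ = r := by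
  have : ‖(σ : E3)‖ = 1 := by simp
  rw [norm_smul, this, Real.norm_of_nonneg hr, mul_one]

theorem smul_mem_exterior {R r : ℝ} (hR : 0 ≤ R) (hr : R < r) (σ : S2) :
    r • (σ : E3) ∈ exterior R := by
  simpa [exterior, norm_smul_sphere (hR.trans hr.le) σ] using hr

theorem hasDerivAt_radial {R : ℝ} (hR : 0 ≤ R) {v : E3 → ℂ} (hv : ContDiffOn ℝ 2 v (exterior R))
    {r : ℝ} (hr : R < r) (σ : S2) :
    HasDerivAt (fun s : ℝ => v (s • (σ : E3))) (fderiv ℝ v (r • (σ : E3)) σ) r := by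
  have hx := smul_mem_exterior hR hr σ
  have h1 := ((hv.contDiffAt ((isOpen_exterior R).mem_nhds hx)).differentiableAt
    two_ne_zero).hasFDerivAt
  have h2 : HasDerivAt (fun s : ℝ => s • (σ : E3)) (σ : E3) r := by
    simpa using (hasDerivAt_id r).smul_const (σ : E3)
  exact h1.comp_hasDerivAt r h2

theorem radialDeriv_eq {R : ℝ} (hR : 0 ≤ R) {v : E3 → ℂ} (hv : ContDiffOn ℝ 2 v (exterior R))
    {r : ℝ} (hr : R < r) (σ : S2) : radialDeriv v r σ = fderiv ℝ v (r • (σ : E3)) σ :=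
  (hasDerivAt_radial hR hv hr σ).deriv

theorem continuous_polyEval_sphere (P : MvPolynomial (Fin 3) ℂ) :
    Continuous fun σ : S2 => polyEval P σ :=
  (contDiff_polyEval P (m := 0)).continuous.comp continuous_subtype_val

theorem continuousOn_smul_sphere {R : ℝ} (hR : 0 ≤ R) {h : E3 → ℂ}
    (hh : ContinuousOn h (exterior R)) :
    ContinuousOn (fun p : ℝ × S2 => h (p.1 • (p.2 : E3))) (Set.Ioi R ×ˢ Set.univ) :=
  hh.comp (by fun_prop) fun p hp => smul_mem_exterior hR hp.1 p.2

theorem continuousOn_radialDeriv {R : ℝ} (hR : 0 ≤ R) {v : E3 → ℂ}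
    (hv : ContDiffOn ℝ 2 v (exterior R)) :
    ContinuousOn (Function.uncurry (radialDeriv v)) (Set.Ioi R ×ˢ Set.univ) := by
  have h1 : ContinuousOn (fun x => fderiv ℝ v x) (exterior R) :=
    hv.continuousOn_fderiv_of_isOpen (isOpen_exterior R) one_le_two
  have h2 : ContinuousOn (fun p : ℝ × S2 => fderiv ℝ v (p.1 • (p.2 : E3)) (p.2 : E3))
      (Set.Ioi R ×ˢ Set.univ) := by
    refine ContinuousOn.clm_apply ?_ (by fun_prop)
    exact h1.comp (by fun_prop) fun p hp => smul_mem_exterior hR hp.1 p.2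
  exact h2.congr fun p hp => radialDeriv_eq hR hv hp.1 p.2

section Moments

variable {R : ℝ} {v : E3 → ℂ}

theorem hasDerivAt_moment (hR : 0 ≤ R) (hv : ContDiffOn ℝ 2 v (exterior R))
    (P : MvPolynomial (Fin 3) ℂ) {r : ℝ} (hr : R < r) :
    HasDerivAt (moment v P) (momentDeriv v P r) r := by
  have hP : ContinuousOn (fun p : ℝ × S2 => polyEval P p.2) (Set.Ioi R ×ˢ Set.univ) :=
    ((continuous_polyEval_sphere P).comp continuous_snd).continuousOn
  refine hasDerivAt_integral_sphere (R := R)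
    (F := fun r σ => v (r • (σ : E3)) * polyEval P σ)
    (F' := fun r σ => radialDeriv v r σ * polyEval P σ) ((continuousOn_smul_sphere hR hv.continuousOn).mul hP)
    ((continuousOn_radialDeriv hR hv).mul hP) (fun s hs σ => ?_) hr
  rw [radialDeriv_eq hR hv hs]
  exact (hasDerivAt_radial hR hv hs σ).mul_const _

theorem continuousOn_momentDeriv (hR : 0 ≤ R) (hv : ContDiffOn ℝ 2 v (exterior R))
    (P : MvPolynomial (Fin 3) ℂ) : ContinuousOn (momentDeriv v P) (Set.Ioi R) :=
  continuousOn_integral_sphere ((continuousOn_radialDeriv hR hv).mul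
    ((continuous_polyEval_sphere P).comp continuous_snd).continuousOn)

/-- The weak form of the radial Helmholtz equation for the moments against a solid harmonic. -/
theorem integral_radial_weak {k : ℝ} (hR : 0 ≤ R) (hv : SolvesHelmholtz k R v)
    {n : ℕ} {P : MvPolynomial (Fin 3) ℂ} (hP : IsSolidHarmonic n P) {φ : ℝ → ℝ}
    (hφ : ContDiff ℝ 1 φ) (hc : HasCompactSupport φ) (hs : tsupport φ ⊆ Set.Ioi R) :
    ∫ r : ℝ, ((deriv φ r : ℝ) : ℂ) *
        ((r : ℂ) ^ (n + 2) * (momentDeriv v P r - n / r * moment v P r)) -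
      φ r * ((k : ℂ) ^ 2 * (r : ℂ) ^ (n + 2) * moment v P r) = 0 := by
  have hz : ∀ r, r ≤ R → φ r = 0 ∧ deriv φ r = 0 := by
    intro r hr
    have h1 : r ∉ tsupport φ := fun h => absurd (hs h) (not_lt.2 hr)
    exact ⟨image_eq_zero_of_notMem_tsupport h1,
      by simpa using (notMem_tsupport_iff_eventuallyEq.1 h1).deriv_eq⟩
  set f : E3 → ℂ := fun x =>
    ∑ i, fderiv ℝ (greenField φ v (polyEval P) i) x (basisVec i) with hf
  have hC : ∀ i, ContDiff ℝ 1 (greenField φ v (polyEval P) i) := fun i =>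
    contDiff_greenField hR hφ hs hv.1 (contDiff_polyEval P) i
  have hcs : ∀ i, HasCompactSupport (greenField φ v (polyEval P) i) := fun i =>
    hasCompactSupport_of_radial hc fun x hx => by simp [greenField, hx]
  have hi : ∀ i, Integrable fun x =>
      fderiv ℝ (greenField φ v (polyEval P) i) x (basisVec i) := fun i =>
    (((hC i).continuous_fderiv one_ne_zero).clm_apply
      continuous_const).integrable_of_hasCompactSupport ((hcs i).fderiv_apply ℝ _)
  have h0 : ∫ x, f x = 0 := by
    rw [integral_finsetSum _ fun i _ => hi i]
    exact Finset.sum_eq_zero fun i _ => integral_fderiv_eq_zero (hC i) (hcs i) _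
  rw [integral_eq_integral_sphere (f := f) (integrable_finsetSum _ fun i _ => hi i)] at h0
  rw [← h0, ← setIntegral_eq_integral_of_forall_compl_eq_zero (s := Set.Ioi (0 : ℝ))]
  · refine setIntegral_congr_fun measurableSet_Ioi fun r hr => ?_
    have hr0 : (0 : ℝ) < r := hr
    by_cases hrR : R < r
    · have hpt : ∀ σ : S2, f (r • (σ : E3)) =
          (((deriv φ r : ℝ) : ℂ) * (r : ℂ) ^ n) * (radialDeriv v r σ * polyEval P σ) -
          (((deriv φ r : ℝ) : ℂ) * (r : ℂ) ^ n * (n / r) + (k : ℂ) ^ 2 * φ r * (r : ℂ) ^ n) *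
            (v (r • (σ : E3)) * polyEval P σ) := by
        intro σ
        have hr' : (r : ℂ) ≠ 0 := by exact_mod_cast hr0.ne'
        rw [hf]
        simp only
        rw [sum_fderiv_greenField hR hφ hv hP (smul_mem_exterior hR hrR σ),
          norm_smul_sphere hr0.le, polyEval_smul hP.1, map_smul, ← radialDeriv_eq hR hv.1 hrR]
        simp only [Complex.real_smul]
        field_simp
        ring
      have hP : Continuous fun σ : S2 => polyEval P σ := continuous_polyEval_sphere P
      have i1 : Integrable (fun σ : S2 => radialDeriv v r σ * polyEval P σ) surf :=
        integrable_of_continuous ((continuous_slice (continuousOn_radialDeriv hR hv.1) hrR).mul hP)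
      have i2 : Integrable (fun σ : S2 => v (r • (σ : E3)) * polyEval P σ) surf :=
        integrable_of_continuous ((continuous_slice
          (F := fun r σ => v (r • (σ : E3)))
          (continuousOn_smul_sphere hR hv.1.continuousOn) hrR).mul hP)
      simp only [hpt]
      rw [integral_sub (i1.const_mul _) (i2.const_mul _), integral_const_mul, integral_const_mul]
      change _ = _ * (_ * momentDeriv v P r - _ * moment v P r)
      push_cast
      ring
    · have hz' := hz r (not_lt.1 hrR)
      have hfz : ∀ σ : S2, f (r • (σ : E3)) = 0 := by
        intro σ
        refine Finset.sum_eq_zero fun i _ => ?_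
        have : r • (σ : E3) ∉ tsupport (greenField φ v (polyEval P) i) := fun h =>
          hrR (by
            have := hs (norm_mem_tsupport (φ := φ) (fun x hx => by simp [greenField, hx]) h)
            rwa [norm_smul_sphere hr0.le] at this)
        rw [(notMem_tsupport_iff_eventuallyEq.1 this).fderiv_eq]
        simp
      simp [hz'.1, hz'.2, hfz]
  · intro r hr
    have hz' := hz r ((not_lt.1 hr).trans hR)
    simp [hz'.1, hz'.2]

end Moments

theorem integrable_ofReal_mul {R : ℝ} {φ : ℝ → ℝ} (hφ : Continuous φ)
    (hc : HasCompactSupport φ) (hs : tsupport φ ⊆ Set.Ioi R) {W : ℝ → ℂ}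
    (hW : ContinuousOn W (Set.Ioi R)) : Integrable fun r => (φ r : ℂ) * W r := by
  have hsupp : tsupport (fun r => (φ r : ℂ) * W r) ⊆ tsupport φ :=
    closure_mono fun x hx h => hx (by simp [h])
  have hcont : Continuous fun r => (φ r : ℂ) * W r := by
    have h : ContinuousOn (fun r => (φ r : ℂ) * W r) (Set.Ioi R) :=
      (Complex.continuous_ofReal.comp hφ).continuousOn.mul hW
    exact h.continuous_of_tsupport_subset isOpen_Ioi (hsupp.trans hs)
  exact hcont.integrable_of_hasCompactSupport
    (hc.isCompact.of_isClosed_subset (isClosed_tsupport _) hsupp)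

theorem exists_Icc_of_tsupport_subset {R : ℝ} {φ : ℝ → ℝ} (hc : HasCompactSupport φ)
    (hs : tsupport φ ⊆ Set.Ioi R) :
    ∃ a b, R < a ∧ a ≤ b ∧ ∀ a' b', a' ≤ a → b ≤ b' → tsupport φ ⊆ Set.Icc a' b' := by
  rcases (tsupport φ).eq_empty_or_nonempty with h | h
  · exact ⟨R + 1, R + 1, by linarith, le_rfl, fun _ _ _ _ => by simp [h]⟩
  · have hcpt : IsCompact (tsupport φ) := hc
    obtain ⟨a, ha, ha'⟩ := hcpt.exists_isLeast h
    obtain ⟨b, hb, hb'⟩ := hcpt.exists_isGreatest h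
    exact ⟨a, b, hs ha, ha' hb, fun a' b' h1 h2 x hx => ⟨h1.trans (ha' hx), (hb' hx).trans h2⟩⟩

/-- A compactly supported function of integral zero has a compactly supported primitive. -/
theorem exists_primitive {R : ℝ} {χ : ℝ → ℝ} (hχ : Continuous χ)
    (hc : HasCompactSupport χ) (hs : tsupport χ ⊆ Set.Ioi R) (h0 : ∫ t, χ t = 0) :
    ∃ φ : ℝ → ℝ, ContDiff ℝ 1 φ ∧ HasCompactSupport φ ∧ tsupport φ ⊆ Set.Ioi R ∧
      ∀ t, deriv φ t = χ t := by
  obtain ⟨a, b, hRa, hab, hsub⟩ := exists_Icc_of_tsupport_subset hc hs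
  have hsub := hsub a b le_rfl le_rfl
  have hz : ∀ t, t ∉ Set.Icc a b → χ t = 0 := fun t ht =>
    image_eq_zero_of_notMem_tsupport fun h => ht (hsub h)
  set φ : ℝ → ℝ := fun t => ∫ s in a..t, χ s with hφdef
  have hd : ∀ t, HasDerivAt φ (χ t) t := fun t =>
    intervalIntegral.integral_hasDerivAt_right (hχ.intervalIntegrable _ _)
      hχ.stronglyMeasurable.stronglyMeasurableAtFilter hχ.continuousAt
  have hφ0 : ∀ t, t ∉ Set.Icc a b → φ t = 0 := by
    intro t ht
    rcases lt_or_ge t a with hta | hta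
    · simp only [φ]
      rw [intervalIntegral.integral_symm, intervalIntegral.integral_of_le hta.le, neg_eq_zero]
      rw [← integral_Ioc_eq_integral_Ioo.symm]
      refine setIntegral_eq_zero_of_forall_eq_zero fun x hx => hz x fun h => ?_
      exact absurd h.1 (not_le.2 hx.2)
    · have htb : b < t := by
        by_contra h
        exact ht ⟨hta, not_lt.1 h⟩
      have : ∫ s in Set.Ioc a t, χ s = ∫ s, χ s := by
        rw [integral_Ioc_eq_integral_Ioo, ← integral_Icc_eq_integral_Ioo]
        refine setIntegral_eq_integral_of_forall_compl_eq_zero fun x hx => hz x fun h => hx ?_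
        exact ⟨h.1, h.2.trans htb.le⟩
      simp only [φ]
      rw [intervalIntegral.integral_of_le hta, this, h0]
  have hts : tsupport φ ⊆ Set.Icc a b :=
    closure_minimal (fun t ht => by_contra fun h => ht (hφ0 t h)) isClosed_Icc
  refine ⟨φ, ?_, isCompact_Icc.of_isClosed_subset (isClosed_tsupport _) hts,
    hts.trans fun t ht => lt_of_lt_of_le hRa ht.1, fun t => (hd t).deriv⟩
  rw [contDiff_one_iff_deriv]
  refine ⟨fun t => (hd t).differentiableAt, ?_⟩
  have : deriv φ = χ := funext fun t => (hd t).deriv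
  rwa [this]

/-- The lemma of du Bois-Reymond on a half line. -/
theorem eq_const_of_integral_deriv_mul_eq_zero {R : ℝ} {W : ℝ → ℂ}
    (hW : ContinuousOn W (Set.Ioi R))
    (h : ∀ φ : ℝ → ℝ, ContDiff ℝ 1 φ → HasCompactSupport φ → tsupport φ ⊆ Set.Ioi R →
      ∫ r, ((deriv φ r : ℝ) : ℂ) * W r = 0) :
    ∃ c, ∀ r, R < r → W r = c := by
  let b : ContDiffBump (R + 2) := ⟨1 / 2, 1, by norm_num, by norm_num⟩
  set η : ℝ → ℝ := b.normed volume with hη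
  have hηc : HasCompactSupport η := b.hasCompactSupport_normed
  have hηs : tsupport η ⊆ Set.Ioi R := by
    rw [hη, b.tsupport_normed_eq]
    intro x hx
    rw [Metric.mem_closedBall, Real.dist_eq, abs_le] at hx
    have : -(1 : ℝ) ≤ x - (R + 2) := hx.1
    exact Set.mem_Ioi.2 (by linarith)
  have hηcont : Continuous η := b.continuous_normed
  have hη1 : ∫ t, η t = 1 := b.integral_normed
  set c : ℂ := ∫ r, (η r : ℂ) * W r with hc
  refine ⟨c, ?_⟩
  have hae : ∀ᵐ x : ℝ, x ∈ Set.Ioi R → W x - c = 0 := by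
    refine isOpen_Ioi.ae_eq_zero_of_integral_contDiff_smul_eq_zero
      ((hW.sub continuousOn_const).locallyIntegrableOn measurableSet_Ioi) fun ψ hψ hψc hψs => ?_
    set m : ℝ := ∫ t, ψ t with hm
    have hψcont : Continuous ψ := hψ.continuous
    have hsub : tsupport (fun t => ψ t - m * η t) ⊆ tsupport ψ ∪ tsupport η := by
      refine closure_minimal (fun t ht => ?_) ((isClosed_tsupport _).union (isClosed_tsupport _))
      by_contra hcon
      rw [Set.mem_union, not_or] at hcon
      exact ht (by simp [image_eq_zero_of_notMem_tsupport hcon.1,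
        image_eq_zero_of_notMem_tsupport hcon.2])
    obtain ⟨φ, hφ, hφc, hφs, hφd⟩ := exists_primitive (R := R) (χ := fun t => ψ t - m * η t)
      (hψcont.sub (continuous_const.mul hηcont))
      ((hψc.isCompact.union hηc.isCompact).of_isClosed_subset (isClosed_tsupport _) hsub)
      (hsub.trans (Set.union_subset hψs hηs)) (by
        rw [integral_sub (hψcont.integrable_of_hasCompactSupport hψc)
          ((hηcont.integrable_of_hasCompactSupport hηc).const_mul m), integral_const_mul, hη1]
        simp [hm])
    have h1 := h φ hφ hφc hφs
    have i1 := integrable_ofReal_mul hψcont hψc hψs hW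
    have i2 := integrable_ofReal_mul hηcont hηc hηs hW
    have h2 : ∫ r, (ψ r : ℂ) * W r = m * c := by
      have e : ∀ r, ((deriv φ r : ℝ) : ℂ) * W r = (ψ r : ℂ) * W r - m * ((η r : ℂ) * W r) := by
        intro r; rw [hφd]; push_cast; ring
      simp only [e] at h1
      rw [integral_sub i1 (i2.const_mul _), integral_const_mul] at h1
      exact sub_eq_zero.1 h1
    have h3 : ∀ r, ψ r • (W r - c) = (ψ r : ℂ) * W r - (ψ r : ℂ) * c := by
      intro r; rw [Complex.real_smul]; ring
    simp only [h3]
    rw [integral_sub i1 (integrable_ofReal_mul hψcont hψc hψs continuousOn_const), h2,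
      integral_mul_const, integral_complex_ofReal, sub_self]
  have heq : Set.EqOn W (fun _ => c) (Set.Ioi R) := by
    refine Measure.eqOn_open_of_ae_eq (μ := volume) ?_ isOpen_Ioi hW continuousOn_const
    rw [Filter.EventuallyEq, ae_restrict_iff' measurableSet_Ioi]
    filter_upwards [hae] with x hx hxR using sub_eq_zero.1 (hx hxR)
  exact fun r hr => heq hr

theorem hasDerivAt_of_weak {R : ℝ} {W S : ℝ → ℂ}
    (hW : ContinuousOn W (Set.Ioi R)) (hS : ContinuousOn S (Set.Ioi R))
    (h : ∀ φ : ℝ → ℝ, ContDiff ℝ 1 φ → HasCompactSupport φ → tsupport φ ⊆ Set.Ioi R →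
      ∫ r, ((deriv φ r : ℝ) : ℂ) * W r - φ r * S r = 0) {r : ℝ} (hr : R < r) :
    HasDerivAt W (-S r) r := by
  set T : ℝ → ℂ := fun t => ∫ s in (R + 1)..t, S s with hT
  have hTd : ∀ t, R < t → HasDerivAt T (S t) t := by
    intro t ht
    have hsub : Set.uIcc (R + 1) t ⊆ Set.Ioi R := fun x hx =>
      lt_of_lt_of_le (lt_min (by linarith) ht) hx.1
    exact intervalIntegral.integral_hasDerivAt_right (hS.mono hsub).intervalIntegrable
      (hS.stronglyMeasurableAtFilter isOpen_Ioi t ht) (hS.continuousAt (Ioi_mem_nhds ht))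
  have hTc : ContinuousOn T (Set.Ioi R) := fun t ht => (hTd t ht).continuousAt.continuousWithinAt
  obtain ⟨c, hc⟩ := eq_const_of_integral_deriv_mul_eq_zero (hW.add hTc) (by
    intro φ hφ hφc hφs
    have hφ' : Continuous (deriv φ) := hφ.continuous_deriv le_rfl
    have hφ's : tsupport (deriv φ) ⊆ tsupport φ := tsupport_deriv_subset
    have i1 := integrable_ofReal_mul hφ' hφc.deriv (hφ's.trans hφs) hW
    have i2 := integrable_ofReal_mul hφ' hφc.deriv (hφ's.trans hφs) hTc
    have i3 := integrable_ofReal_mul hφ.continuous hφc hφs hS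
    have i4 := integrable_ofReal_mul hφ.continuous hφc hφs hTc
    have h1 := h φ hφ hφc hφs
    rw [integral_sub i1 i3, sub_eq_zero] at h1
    have hts : tsupport (fun r => (φ r : ℂ)) ⊆ Set.Ioi R :=
      by
      have h4 : Function.support (fun r => (φ r : ℂ)) ⊆ Function.support φ :=
        fun x hx h => hx (by simp [h])
      exact (closure_mono h4).trans hφs
    have h2 := integral_bilinear_hasLineDerivAt_right_eq_neg_left_of_integrable
      (μ := (volume : Measure ℝ)) (f := fun r => (φ r : ℂ)) (f' := fun r => ((deriv φ r : ℝ) : ℂ))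
      (g := T) (g' := S) (v := (1 : ℝ)) (B := ContinuousLinearMap.mul ℝ ℂ)
      (by simpa using i2) (by simpa using i3) (by simpa using i4)
      (fun x _ => by
        have := ((hφ.differentiable one_ne_zero) x).hasDerivAt.ofReal_comp
        simpa using this.hasFDerivAt.hasLineDerivAt (1 : ℝ))
      (fun x hx => by simpa using (hTd x (hts hx)).hasFDerivAt.hasLineDerivAt (1 : ℝ))
    simp only [ContinuousLinearMap.mul_apply'] at h2
    simp only [Pi.add_apply, mul_add]
    rw [integral_add i1 i2, h1, h2]
    ring)
  have hev : W =ᶠ[𝓝 r] fun t => c - T t := by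
    filter_upwards [Ioi_mem_nhds hr] with t ht
    rw [← hc t ht]; simp
  exact ((hTd r hr).const_sub c).congr_of_eventuallyEq hev

theorem hasDerivAt_radial_moment {k R : ℝ} {v : E3 → ℂ} (hR : 0 ≤ R) (hv : SolvesHelmholtz k R v)
    {n : ℕ} {P : MvPolynomial (Fin 3) ℂ} (hP : IsSolidHarmonic n P) {r : ℝ} (hr : R < r) :
    HasDerivAt (fun s : ℝ => momentDeriv v P s - n / s * moment v P s)
      (-((n + 2) / r * (momentDeriv v P r - n / r * moment v P r)) -
        (k : ℂ) ^ 2 * moment v P r) r := by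
  have hpow : ContinuousOn (fun s : ℝ => (s : ℂ) ^ (n + 2)) (Set.Ioi R) := by fun_prop
  have hmc : ContinuousOn (moment v P) (Set.Ioi R) := fun s hs =>
    (hasDerivAt_moment hR hv.1 P hs).continuousAt.continuousWithinAt
  have hne : ∀ s ∈ Set.Ioi R, (s : ℂ) ≠ 0 := fun s hs => by
    exact_mod_cast (lt_of_le_of_lt hR hs).ne'
  have hdiv : ContinuousOn (fun s : ℝ => (n : ℂ) / s) (Set.Ioi R) :=
    continuousOn_const.div (by fun_prop) hne
  have hq : ContinuousOn (fun s : ℝ => momentDeriv v P s - n / s * moment v P s) (Set.Ioi R) :=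
    (continuousOn_momentDeriv hR hv.1 P).sub (hdiv.mul hmc)
  have hd := hasDerivAt_of_weak (R := R)
    (W := fun s => (s : ℂ) ^ (n + 2) * (momentDeriv v P s - n / s * moment v P s))
    (S := fun s => (k : ℂ) ^ 2 * (s : ℂ) ^ (n + 2) * moment v P s)
    (hpow.mul hq) ((continuousOn_const.mul hpow).mul hmc)
    (fun φ h1 h2 h3 => integral_radial_weak hR hv hP h1 h2 h3) hr
  have hr0 := hne r hr
  have hp : HasDerivAt (fun s : ℝ => (s : ℂ) ^ (n + 2)) ((n + 2 : ℕ) * (r : ℂ) ^ (n + 1)) r := by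
    simpa using (hasDerivAt_pow (n + 2) (r : ℂ)).comp_ofReal
  have hd2 := hd.div hp (pow_ne_zero _ hr0)
  refine (hd2.congr_of_eventuallyEq ?_).congr_deriv ?_
  · filter_upwards [Ioi_mem_nhds hr] with s hs
    have := hne s hs
    simp only [Pi.div_apply]
    field_simp
  · push_cast
    field_simp
    ring

/-- The outgoing spherical Hankel functions, normalized by `h₀(z) = e^{iz} / z`. -/
def hankel : ℕ → ℝ → ℂ
  | 0, z => Complex.exp (Complex.I * z) / z
  | 1, z => (1 / (z : ℂ) ^ 2 - Complex.I / z) * Complex.exp (Complex.I * z)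
  | n + 2, z => (2 * n + 3) / z * hankel (n + 1) z - hankel n z

/-- The derivative of `hankel n`. -/
def hankelDeriv (n : ℕ) (z : ℝ) : ℂ := n / z * hankel n z - hankel (n + 1) z

theorem hasDerivAt_cexp_ofReal (z : ℝ) :
    HasDerivAt (fun t : ℝ => Complex.exp (Complex.I * t))
      (Complex.I * Complex.exp (Complex.I * z)) z := by
  have h := (((hasDerivAt_id (z : ℂ)).const_mul Complex.I).cexp).comp_ofReal
  simpa [mul_comm] using h

theorem hasDerivAt_hankel_pair (n : ℕ) {z : ℝ} (hz : 0 < z) :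
    HasDerivAt (hankel n) (hankelDeriv n z) z ∧
      HasDerivAt (hankel (n + 1)) (hankel n z - (n + 2) / z * hankel (n + 1) z) z := by
  have hz' : (z : ℂ) ≠ 0 := by exact_mod_cast hz.ne'
  have hid : HasDerivAt (fun t : ℝ => (t : ℂ)) 1 z := by
    simpa using (hasDerivAt_id (z : ℂ)).comp_ofReal
  induction n with
  | zero =>
    have he := hasDerivAt_cexp_ofReal z
    constructor
    · refine (he.div hid hz').congr_deriv ?_
      simp only [hankelDeriv, hankel]
      field_simp
      simp
    · have h1 : HasDerivAt (fun t : ℝ => 1 / (t : ℂ) ^ 2 - Complex.I / t)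
          (-2 / (z : ℂ) ^ 3 + Complex.I / (z : ℂ) ^ 2) z := by
        refine (((hasDerivAt_const z (1 : ℂ)).div (hid.pow 2) (pow_ne_zero 2 hz')).sub
          ((hasDerivAt_const z Complex.I).div hid hz')).congr_deriv ?_
        simp only [Pi.pow_apply]
        field_simp
        ring
      refine (h1.mul he).congr_deriv ?_
      simp only [hankel]
      field_simp
      ring_nf
      simp only [Complex.I_sq]
      ring
  | succ n ih =>
    have hrec : hankel n z = (2 * n + 3) / z * hankel (n + 1) z - hankel (n + 2) z := by
      simp [hankel]
    constructor
    · refine ih.2.congr_deriv ?_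
      rw [hrec, hankelDeriv]
      push_cast
      field_simp
      ring
    · have h1 : HasDerivAt (fun t : ℝ => (2 * (n : ℂ) + 3) / t) (-(2 * n + 3) / (z : ℂ) ^ 2) z := by
        refine ((hasDerivAt_const z (2 * (n : ℂ) + 3)).div hid hz').congr_deriv ?_
        ring
      have h2 := (h1.mul ih.2).sub ih.1
      refine h2.congr_deriv ?_
      rw [hankelDeriv, hrec]
      push_cast
      field_simp
      ring

theorem hasDerivAt_hankel (n : ℕ) {z : ℝ} (hz : 0 < z) :
    HasDerivAt (hankel n) (hankelDeriv n z) z := (hasDerivAt_hankel_pair n hz).1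

theorem hasDerivAt_hankel_succ (n : ℕ) {z : ℝ} (hz : 0 < z) :
    HasDerivAt (hankel (n + 1)) (hankel n z - (n + 2) / z * hankel (n + 1) z) z :=
  (hasDerivAt_hankel_pair n hz).2

theorem hankelDeriv_succ (n : ℕ) {z : ℝ} (hz : 0 < z) :
    hankelDeriv (n + 1) z = hankel n z - (n + 2) / z * hankel (n + 1) z :=
  (hasDerivAt_hankel (n + 1) hz).unique (hasDerivAt_hankel_succ n hz)

theorem norm_cexp_I_mul (z : ℝ) : ‖Complex.exp (Complex.I * z)‖ = 1 := by
  rw [mul_comm, Complex.norm_exp_ofReal_mul_I]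

theorem exp_half_mul_add_one_le {t : ℝ} (ht : 0 ≤ t) :
    t * Real.exp (t / 2) + 1 ≤ Real.exp t := by
  have h1 : Real.exp t = Real.exp (t / 2) * Real.exp (t / 2) := by
    rw [← Real.exp_add]; ring_nf
  have h2 := Real.self_le_sinh_iff.2 (by linarith : 0 ≤ t / 2)
  rw [Real.sinh_eq] at h2
  have h3 : Real.exp (t / 2) * Real.exp (-(t / 2)) = 1 := by rw [← Real.exp_add]; simp
  have h4 := Real.exp_pos (t / 2)
  nlinarith

theorem norm_mul_hankel_le (n : ℕ) {z : ℝ} (hz : 0 < z) :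
    z * ‖hankel n z‖ ≤ Real.exp (n * (n + 1) / (2 * z)) := by
  induction n using Nat.twoStepInduction with
  | zero =>
    simp [hankel, abs_of_pos hz, hz.ne']
  | one =>
    have h1 : ‖hankel 1 z‖ ≤ 1 / z ^ 2 + 1 / z := by
      rw [hankel, norm_mul, norm_cexp_I_mul, mul_one]
      refine (norm_sub_le _ _).trans (le_of_eq ?_)
      simp [abs_of_pos hz]
    have h2 := Real.add_one_le_exp (1 / z)
    calc z * ‖hankel 1 z‖ ≤ z * (1 / z ^ 2 + 1 / z) := by gcongr
      _ = 1 / z + 1 := by field_simp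
      _ ≤ Real.exp (1 / z) := h2
      _ = _ := by congr 1; field_simp; norm_num
  | more n h0 h1 =>
    set x : ℝ := 1 / (2 * z) with hx
    have hxp : 0 < x := by positivity
    have e0 : (n : ℝ) * (n + 1) / (2 * z) = n * (n + 1) * x := by rw [hx]; ring
    have e1 : ((n + 1 : ℕ) : ℝ) * ((n + 1 : ℕ) + 1) / (2 * z) = (n + 1) * (n + 2) * x := by
      rw [hx]; push_cast; ring
    have e2 : ((n + 2 : ℕ) : ℝ) * ((n + 2 : ℕ) + 1) / (2 * z) = (n + 2) * (n + 3) * x := by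
      rw [hx]; push_cast; ring
    have e3 : (2 * (n : ℝ) + 3) / z = 2 * (2 * n + 3) * x := by rw [hx]; field_simp
    rw [e0] at h0
    rw [e1] at h1
    rw [e2]
    have hb : ‖hankel (n + 2) z‖ ≤ (2 * n + 3) / z * ‖hankel (n + 1) z‖ + ‖hankel n z‖ := by
      rw [hankel]
      refine (norm_sub_le _ _).trans (le_of_eq ?_)
      have : ‖(2 * (n : ℂ) + 3)‖ = 2 * n + 3 := by
        have : (2 * (n : ℂ) + 3) = ((2 * n + 3 : ℕ) : ℂ) := by push_cast; ring
        rw [this, Complex.norm_natCast]; push_cast; ring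
      rw [norm_mul, norm_div, this, Complex.norm_real, Real.norm_of_nonneg hz.le]
    set t : ℝ := 2 * (2 * n + 3) * x with ht
    have ht0 : 0 ≤ t := by positivity
    set B := Real.exp (n * (n + 1) * x)
    have hB : 0 < B := Real.exp_pos _
    have h3 : Real.exp ((n + 1) * (n + 2) * x) ≤ B * Real.exp (t / 2) := by
      rw [← Real.exp_add]
      refine Real.exp_le_exp.2 ?_
      rw [ht]; nlinarith
    have h4 : Real.exp ((n + 2) * (n + 3) * x) = B * Real.exp t := by
      rw [← Real.exp_add]; congr 1; rw [ht]; ring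
    have h5 := exp_half_mul_add_one_le ht0
    rw [h4]
    calc z * ‖hankel (n + 2) z‖
        ≤ z * ((2 * n + 3) / z * ‖hankel (n + 1) z‖ + ‖hankel n z‖) := by gcongr
      _ = t * (z * ‖hankel (n + 1) z‖) + z * ‖hankel n z‖ := by rw [e3]; ring
      _ ≤ t * (B * Real.exp (t / 2)) + B :=
        add_le_add (mul_le_mul_of_nonneg_left (h1.trans h3) ht0) h0
      _ = B * (t * Real.exp (t / 2) + 1) := by ring
      _ ≤ B * Real.exp t := by gcongr

theorem tendsto_hankel (n : ℕ) :
    Tendsto (fun z : ℝ => z * Complex.exp (-(Complex.I * z)) * hankel n z) atTop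
      (𝓝 ((-Complex.I) ^ n)) := by
  have hinv : Tendsto (fun z : ℝ => (z : ℂ)⁻¹) atTop (𝓝 0) := by
    have h := (Complex.continuous_ofReal.tendsto 0).comp tendsto_inv_atTop_zero
    simpa [Function.comp_def] using h
  have hexp : ∀ z : ℝ, Complex.exp (-(Complex.I * z)) * Complex.exp (Complex.I * z) = 1 := by
    intro z; rw [← Complex.exp_add]; simp
  induction n using Nat.twoStepInduction with
  | zero =>
    refine tendsto_const_nhds.congr' ?_
    filter_upwards [eventually_gt_atTop 0] with z hz
    have hz' : (z : ℂ) ≠ 0 := by exact_mod_cast hz.ne'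
    simp only [hankel]
    field_simp
    simpa [mul_comm] using (hexp z).symm
  | one =>
    have h : Tendsto (fun z : ℝ => (z : ℂ)⁻¹ - Complex.I) atTop (𝓝 (0 - Complex.I)) :=
      hinv.sub_const _
    rw [zero_sub] at h
    rw [pow_one]
    refine h.congr' ?_
    filter_upwards [eventually_gt_atTop 0] with z hz
    have hz' : (z : ℂ) ≠ 0 := by exact_mod_cast hz.ne'
    simp only [hankel]
    have : z * Complex.exp (-(Complex.I * z)) *
        ((1 / (z : ℂ) ^ 2 - Complex.I / z) * Complex.exp (Complex.I * z)) =
        z * (1 / (z : ℂ) ^ 2 - Complex.I / z) *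
          (Complex.exp (-(Complex.I * z)) * Complex.exp (Complex.I * z)) := by ring
    rw [this, hexp]
    field_simp
  | more n h0 h1 =>
    have h := ((hinv.const_mul (2 * (n : ℂ) + 3)).mul h1).sub h0
    have e : (2 * (n : ℂ) + 3) * 0 * (-Complex.I) ^ (n + 1) - (-Complex.I) ^ n =
        (-Complex.I) ^ (n + 2) := by
      rw [pow_add _ n 2, neg_sq, Complex.I_sq]; ring
    rw [e] at h
    refine h.congr fun z => ?_
    simp only [hankel]
    ring

/-- The pair `(g, q)`, with `q = g' - (n / r) g`, solves the radial Helmholtz equation of degree `n`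
on `(R, ∞)`. -/
structure IsRadialSolution (k R : ℝ) (n : ℕ) (g q : ℝ → ℂ) : Prop where
  hasDerivAt_fst : ∀ r, R < r → HasDerivAt g (q r + n / r * g r) r
  hasDerivAt_snd : ∀ r, R < r → HasDerivAt q (-((n + 2) / r * q r) - (k : ℂ) ^ 2 * g r) r

/-- A solution of the radial Helmholtz equation that is outgoing, with amplitude `a`. -/
structure IsOutgoing (k R : ℝ) (n : ℕ) (g q : ℝ → ℂ) (a : ℂ) : Prop
    extends IsRadialSolution k R n g q where
  tendsto_fst : Tendsto (fun r : ℝ => r * Complex.exp (-(Complex.I * k * r)) * g r) atTop (𝓝 a)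
  tendsto_snd : Tendsto (fun r : ℝ => r * Complex.exp (-(Complex.I * k * r)) * q r) atTop
    (𝓝 (Complex.I * k * a))

section Wronskian

variable {k R : ℝ} {n : ℕ} {g₁ q₁ g₂ q₂ : ℝ → ℂ} {a b : ℂ}

theorem IsRadialSolution.wronskian_const (hR : 0 ≤ R) (h₁ : IsRadialSolution k R n g₁ q₁)
    (h₂ : IsRadialSolution k R n g₂ q₂) :
    ∃ c, ∀ r : ℝ, R < r → (r : ℂ) ^ 2 * (q₁ r * g₂ r - g₁ r * q₂ r) = c := by
  have hd : ∀ r : ℝ, R < r →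
      HasDerivAt (fun r : ℝ => (r : ℂ) ^ 2 * (q₁ r * g₂ r - g₁ r * q₂ r)) 0 r := by
    intro r hr
    have hr0 : (r : ℂ) ≠ 0 := by exact_mod_cast (lt_of_le_of_lt hR hr).ne'
    have hp : HasDerivAt (fun s : ℝ => (s : ℂ) ^ 2) (2 * r) r := by
      simpa using (hasDerivAt_pow 2 (r : ℂ)).comp_ofReal
    refine (hp.mul (((h₁.hasDerivAt_snd r hr).mul (h₂.hasDerivAt_fst r hr)).sub
      ((h₁.hasDerivAt_fst r hr).mul (h₂.hasDerivAt_snd r hr)))).congr_deriv ?_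
    simp only [Pi.sub_apply, Pi.mul_apply]
    field_simp
    ring
  obtain ⟨c, hc⟩ := isOpen_Ioi.exists_is_const_of_deriv_eq_zero (s := Set.Ioi R)
    isPreconnected_Ioi (fun r hr => (hd r hr).differentiableAt.differentiableWithinAt)
    (fun r hr => (hd r hr).deriv)
  exact ⟨c, hc⟩

theorem IsRadialSolution.conj (h : IsRadialSolution k R n g₁ q₁) :
    IsRadialSolution k R n (fun r => starRingEnd ℂ (g₁ r)) (fun r => starRingEnd ℂ (q₁ r)) where
  hasDerivAt_fst r hr := by
    have := (h.hasDerivAt_fst r hr).star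
    simpa using this
  hasDerivAt_snd r hr := by
    have := (h.hasDerivAt_snd r hr).star
    simpa using this

theorem IsOutgoing.wronskian_eq_zero (hR : 0 ≤ R) (h₁ : IsOutgoing k R n g₁ q₁ a)
    (h₂ : IsOutgoing k R n g₂ q₂ b) {r : ℝ} (hr : R < r) : q₁ r * g₂ r = g₁ r * q₂ r := by
  obtain ⟨c, hc⟩ := h₁.toIsRadialSolution.wronskian_const hR h₂.toIsRadialSolution
  have hlim := (h₁.tendsto_snd.mul h₂.tendsto_fst).sub (h₁.tendsto_fst.mul h₂.tendsto_snd)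
  rw [show Complex.I * k * a * b - a * (Complex.I * k * b) = 0 by ring] at hlim
  have hn : Tendsto (fun _ : ℝ => ‖c‖) atTop (𝓝 ‖(0 : ℂ)‖) := by
    refine hlim.norm.congr' ?_
    filter_upwards [eventually_gt_atTop R] with s hs
    rw [← hc s hs]
    have : (s : ℂ) * Complex.exp (-(Complex.I * k * s)) * q₁ s *
          (s * Complex.exp (-(Complex.I * k * s)) * g₂ s) -
        s * Complex.exp (-(Complex.I * k * s)) * g₁ s *
          (s * Complex.exp (-(Complex.I * k * s)) * q₂ s) =
        Complex.exp (Complex.I * ((-(k * s) : ℝ) : ℂ)) ^ 2 *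
          ((s : ℂ) ^ 2 * (q₁ s * g₂ s - g₁ s * q₂ s)) := by
      rw [show Complex.I * ((-(k * s) : ℝ) : ℂ) = -(Complex.I * k * s) by push_cast; ring]
      ring
    rw [this, norm_mul, norm_pow, norm_cexp_I_mul, one_pow, one_mul]
  have hc0 : c = 0 := by simpa using tendsto_nhds_unique hn tendsto_const_nhds |>.symm
  have h := hc r hr
  rw [hc0] at h
  have hr0 : (r : ℂ) ≠ 0 := by exact_mod_cast (lt_of_le_of_lt hR hr).ne'
  exact sub_eq_zero.1 ((mul_eq_zero.1 h).resolve_left (pow_ne_zero 2 hr0))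

theorem IsOutgoing.wronskian_conj (hR : 0 ≤ R) (h₁ : IsOutgoing k R n g₁ q₁ a)
    (h₂ : IsOutgoing k R n g₂ q₂ b) {r : ℝ} (hr : R < r) :
    (r : ℂ) ^ 2 * (q₁ r * starRingEnd ℂ (g₂ r) - g₁ r * starRingEnd ℂ (q₂ r)) =
      2 * Complex.I * k * a * starRingEnd ℂ b := by
  obtain ⟨c, hc⟩ := h₁.toIsRadialSolution.wronskian_const hR h₂.toIsRadialSolution.conj
  have hg := (Complex.continuous_conj.tendsto _).comp h₂.tendsto_fst
  have hq := (Complex.continuous_conj.tendsto _).comp h₂.tendsto_snd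
  have hlim := (h₁.tendsto_snd.mul hg).sub (h₁.tendsto_fst.mul hq)
  have hcl : Tendsto (fun _ : ℝ => c) atTop (𝓝 (2 * Complex.I * k * a * starRingEnd ℂ b)) := by
    convert hlim.congr' ?_ using 2
    · simp; ring
    · filter_upwards [eventually_gt_atTop R] with s hs
      rw [← hc s hs]
      have he : Complex.exp (-(Complex.I * k * s)) * Complex.exp (Complex.I * k * s) = 1 := by
        rw [← Complex.exp_add]; simp
      simp only [Function.comp_apply, map_mul, ← Complex.exp_conj, map_neg, Complex.conj_I,
        Complex.conj_ofReal, neg_mul, neg_neg]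
      linear_combination (s : ℂ) ^ 2 * (q₁ s * starRingEnd ℂ (g₂ s) -
        g₁ s * starRingEnd ℂ (q₂ s)) * he
  rw [hc r hr]
  exact tendsto_nhds_unique tendsto_const_nhds hcl

/-- Outgoing solutions of the radial Helmholtz equation are proportional. -/
theorem IsOutgoing.proportional (hk : k ≠ 0) (hR : 0 ≤ R) (h₁ : IsOutgoing k R n g₁ q₁ a)
    (h₂ : IsOutgoing k R n g₂ q₂ b) (hb : b ≠ 0) {r : ℝ} (hr : R < r) :
    b * g₁ r = a * g₂ r ∧ b * q₁ r = a * q₂ r := by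
  have w0 := h₁.wronskian_eq_zero hR h₂ hr
  have w1 := h₁.wronskian_conj hR h₂ hr
  have w2 := h₂.wronskian_conj hR h₂ hr
  have hb' : starRingEnd ℂ b ≠ 0 := by simpa using hb
  have hk' : (k : ℂ) ≠ 0 := by exact_mod_cast hk
  have hne : 2 * Complex.I * k * starRingEnd ℂ b ≠ 0 := by simp [hk, hb]
  constructor
  · refine mul_left_cancel₀ hne ?_
    linear_combination (-g₁ r) * w2 + g₂ r * w1 - (r : ℂ) ^ 2 * starRingEnd ℂ (g₂ r) * w0
  · refine mul_left_cancel₀ hne ?_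
    linear_combination (-q₁ r) * w2 + q₂ r * w1 - (r : ℂ) ^ 2 * starRingEnd ℂ (q₂ r) * w0

end Wronskian

theorem isOutgoing_hankel {k : ℝ} (hk : 0 < k) (n : ℕ) :
    IsOutgoing k 0 n (fun r => hankel n (k * r)) (fun r => -k * hankel (n + 1) (k * r))
      ((-Complex.I) ^ n / k) where
  hasDerivAt_fst r hr := by
    have h := (hasDerivAt_hankel n (mul_pos hk hr)).scomp r ((hasDerivAt_id r).const_mul k)
    refine h.congr_deriv ?_
    have hr' : (r : ℂ) ≠ 0 := by exact_mod_cast hr.ne'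
    have hk' : (k : ℂ) ≠ 0 := by exact_mod_cast hk.ne'
    simp only [hankelDeriv, Complex.real_smul]
    push_cast
    field_simp
    ring
  hasDerivAt_snd r hr := by
    have h := ((hasDerivAt_hankel_succ n (mul_pos hk hr)).scomp r
      ((hasDerivAt_id r).const_mul k)).const_mul (-k : ℂ)
    refine h.congr_deriv ?_
    have hr' : (r : ℂ) ≠ 0 := by exact_mod_cast hr.ne'
    have hk' : (k : ℂ) ≠ 0 := by exact_mod_cast hk.ne'
    simp only [Complex.real_smul]
    push_cast
    field_simp
    ring
  tendsto_fst := by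
    have h := ((tendsto_hankel n).comp (tendsto_id.const_mul_atTop hk)).div_const (k : ℂ)
    refine h.congr fun r => ?_
    have hk' : (k : ℂ) ≠ 0 := by exact_mod_cast hk.ne'
    simp only [Function.comp_apply, id]
    push_cast
    rw [← mul_assoc Complex.I]
    field_simp
  tendsto_snd := by
    have h := ((tendsto_hankel (n + 1)).comp (tendsto_id.const_mul_atTop hk)).neg
    have hk' : (k : ℂ) ≠ 0 := by exact_mod_cast hk.ne'
    convert h using 2
    · simp only [Function.comp_apply, id]
      push_cast
      rw [← mul_assoc Complex.I]
      ring
    · field_simp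
      ring

section FarField

variable {k R : ℝ} {v : E3 → ℂ}

/-- The rescaled far field `r e^{-ikr} v(rσ)`. -/
def farField (k : ℝ) (v : E3 → ℂ) (r : ℝ) (σ : S2) : ℂ :=
  r * Complex.exp (-(Complex.I * k * r)) * v (r • (σ : E3))

theorem norm_cexp_neg (k r : ℝ) : ‖Complex.exp (-(Complex.I * k * r))‖ = 1 := by
  have := norm_cexp_I_mul (-(k * r))
  rw [← this]; congr 2; push_cast; ring

theorem tendstoUniformly_farField {A : S2 → ℂ} (hA : IsScatteringAmplitude k v A) :
    TendstoUniformly (farField k v) A atTop := by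
  obtain ⟨C, r₀, hC⟩ := hA
  rw [Metric.tendstoUniformly_iff]
  intro ε hε
  have hlim : Tendsto (fun r : ℝ => C / r) atTop (𝓝 0) := tendsto_const_nhds.div_atTop tendsto_id
  filter_upwards [eventually_ge_atTop r₀, eventually_gt_atTop 0, hlim.eventually_lt_const hε]
    with r hr hr0 hrε σ
  refine lt_of_le_of_lt ?_ hrε
  have hr' : (r : ℂ) ≠ 0 := by exact_mod_cast hr0.ne'
  have he : Complex.exp (-(Complex.I * k * r)) * Complex.exp (Complex.I * k * r) = 1 := by
    rw [← Complex.exp_add]; simp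
  have e : farField k v r σ - A σ = r * Complex.exp (-(Complex.I * k * r)) *
      (v (r • (σ : E3)) - Complex.exp (Complex.I * k * r) / r * A σ) := by
    rw [farField]
    generalize Complex.exp (-(Complex.I * k * r)) = x at he ⊢
    generalize Complex.exp (Complex.I * k * r) = y at he ⊢
    field_simp
    linear_combination A σ * he
  rw [dist_comm, dist_eq_norm, e, norm_mul, norm_mul, norm_cexp_neg, mul_one, Complex.norm_real,
    Real.norm_of_nonneg hr0.le]
  calc r * _ ≤ r * (C / r ^ 2) := by gcongr; exact hC r hr hr0 σ
    _ = C / r := by field_simp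

theorem continuous_scatteringAmplitude (hR : 0 ≤ R) (hv : SolvesHelmholtz k R v) {A : S2 → ℂ}
    (hA : IsScatteringAmplitude k v A) : Continuous A := by
  refine (tendstoUniformly_farField hA).continuous (Eventually.frequently ?_)
  filter_upwards [eventually_gt_atTop R] with r hr
  exact continuous_const.mul (continuous_slice (F := fun r σ => v (r • (σ : E3)))
    (continuousOn_smul_sphere hR hv.1.continuousOn) hr)

theorem tendsto_integral_mul_of_tendstoUniformly {F : ℝ → S2 → ℂ} {f p : S2 → ℂ}
    (hF : ∀ᶠ r in atTop, Continuous (F r)) (hp : Continuous p)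
    (h : TendstoUniformly F f atTop) :
    Tendsto (fun r => ∫ σ, F r σ * p σ ∂surf) atTop (𝓝 (∫ σ, f σ * p σ ∂surf)) := by
  have hf : Continuous f := h.continuous hF.frequently
  obtain ⟨M, hM⟩ := isCompact_univ.exists_bound_of_continuousOn hf.continuousOn
  obtain ⟨M', hM'⟩ := isCompact_univ.exists_bound_of_continuousOn hp.continuousOn
  refine tendsto_integral_filter_of_dominated_convergence (fun _ => (M + 1) * M') ?_ ?_
    (integrable_const _) ?_
  · filter_upwards [hF] with r hr using (hr.mul hp).aestronglyMeasurable
  · filter_upwards [Metric.tendstoUniformly_iff.1 h 1 one_pos] with r hr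
    refine Eventually.of_forall fun σ => ?_
    rw [norm_mul]
    have h1 : ‖F r σ‖ ≤ M + 1 := by
      have h2 := hr σ
      rw [dist_comm, dist_eq_norm] at h2
      have h3 := norm_add_le (F r σ - f σ) (f σ)
      rw [sub_add_cancel] at h3
      linarith [hM σ trivial]
    exact mul_le_mul h1 (hM' σ trivial) (norm_nonneg _) ((norm_nonneg _).trans h1)
  · exact Eventually.of_forall fun σ => (h.tendsto_at σ).mul_const _

theorem isOutgoing_moment (hR : 0 ≤ R) (hv : SolvesHelmholtz k R v) (hrad : Radiating k v)
    {A : S2 → ℂ} (hA : IsScatteringAmplitude k v A) {n : ℕ} {P : MvPolynomial (Fin 3) ℂ}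
    (hP : IsSolidHarmonic n P) :
    IsOutgoing k R n (moment v P) (fun r => momentDeriv v P r - n / r * moment v P r)
      (∫ σ, A σ * polyEval P σ ∂surf) := by
  have hpc := continuous_polyEval_sphere P
  have hvc : ∀ r, R < r → Continuous fun σ : S2 => v (r • (σ : E3)) := fun r hr =>
    continuous_slice (F := fun r σ => v (r • (σ : E3)))
      (continuousOn_smul_sphere hR hv.1.continuousOn) hr
  have hdc : ∀ r, R < r → Continuous (radialDeriv v r) := fun r hr =>
    continuous_slice (continuousOn_radialDeriv hR hv.1) hr
  have hlim1 : Tendsto (fun r : ℝ => r * Complex.exp (-(Complex.I * k * r)) * moment v P r) atTop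
      (𝓝 (∫ σ, A σ * polyEval P σ ∂surf)) := by
    refine (tendsto_integral_mul_of_tendstoUniformly ?_ hpc (tendstoUniformly_farField hA)).congr
      fun r => ?_
    · filter_upwards [eventually_gt_atTop R] with r hr using continuous_const.mul (hvc r hr)
    · simp only [farField, mul_assoc]
      rw [integral_const_mul, integral_const_mul, moment]
  refine ⟨⟨fun r hr => ?_, fun r hr => ?_⟩, hlim1, ?_⟩
  · simpa using hasDerivAt_moment hR hv.1 P hr
  · exact hasDerivAt_radial_moment hR hv hP hr
  · have hlim2 : Tendsto (fun r : ℝ => (r : ℂ) * (momentDeriv v P r -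
        Complex.I * k * moment v P r)) atTop (𝓝 0) := by
      have h := tendsto_integral_mul_of_tendstoUniformly (p := fun σ => polyEval P σ) (by
        filter_upwards [eventually_gt_atTop R] with r hr
        exact continuous_const.mul ((hdc r hr).sub (continuous_const.mul (hvc r hr)))) hpc hrad
      simp only [zero_mul, integral_zero] at h
      refine h.congr' ?_
      filter_upwards [eventually_gt_atTop R] with r hr
      have i1 : Integrable (fun σ : S2 => radialDeriv v r σ * polyEval P σ) surf :=
        integrable_of_continuous ((hdc r hr).mul hpc)
      have i2 : Integrable (fun σ : S2 => v (r • (σ : E3)) * polyEval P σ) surf :=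
        integrable_of_continuous ((hvc r hr).mul hpc)
      rw [momentDeriv, moment, ← integral_const_mul, ← integral_sub i1 (i2.const_mul _),
        ← integral_const_mul]
      exact integral_congr_ae (Eventually.of_forall fun σ => by ring)
    have hinv : Tendsto (fun z : ℝ => (z : ℂ)⁻¹) atTop (𝓝 0) := by
      have h := (Complex.continuous_ofReal.tendsto 0).comp tendsto_inv_atTop_zero
      simpa [Function.comp_def] using h
    have hlim2' : Tendsto (fun r : ℝ => Complex.exp (-(Complex.I * k * r)) *
        ((r : ℂ) * (momentDeriv v P r - Complex.I * k * moment v P r))) atTop (𝓝 0) := by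
      rw [tendsto_zero_iff_norm_tendsto_zero] at hlim2 ⊢
      simpa [norm_mul, norm_cexp_neg] using hlim2
    have h := (hlim2'.add (hlim1.const_mul (Complex.I * k))).sub
      ((hinv.const_mul (n : ℂ)).mul hlim1)
    simp only [mul_zero, zero_mul, sub_zero, zero_add] at h
    refine h.congr fun r => ?_
    ring

theorem tendsto_momentDeriv {g : S2 → ℂ} (hR : 0 ≤ R) (hv : ContDiffOn ℝ 2 v (exterior R))
    (hg : MemLp g 2 surf) (hN : NeumannData R v g) (P : MvPolynomial (Fin 3) ℂ) :
    Tendsto (momentDeriv v P) (𝓝[>] R) (𝓝 (∫ σ, g σ * polyEval P σ ∂surf)) := by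
  have hpc := continuous_polyEval_sphere P
  have hp2 : MemLp (fun σ : S2 => polyEval P σ) 2 surf :=
    hpc.memLp_of_hasCompactSupport (HasCompactSupport.of_compactSpace _)
  have hgp : Integrable (fun σ : S2 => g σ * polyEval P σ) surf := hg.integrable_mul hp2
  rw [tendsto_iff_edist_tendsto_0]
  have hlim : Tendsto (fun r => eLpNorm (fun σ => radialDeriv v r σ - g σ) 2 surf *
      eLpNorm (fun σ : S2 => polyEval P σ) 2 surf) (𝓝[>] R) (𝓝 0) := by
    have := ENNReal.Tendsto.mul_const hN (Or.inr hp2.eLpNorm_ne_top)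
    simpa using this
  refine tendsto_of_tendsto_of_tendsto_of_le_of_le' tendsto_const_nhds hlim
    (Eventually.of_forall fun _ => zero_le) ?_
  filter_upwards [self_mem_nhdsWithin] with r hr
  have hdc : Continuous (radialDeriv v r) := continuous_slice (continuousOn_radialDeriv hR hv) hr
  have i1 : Integrable (fun σ : S2 => radialDeriv v r σ * polyEval P σ) surf :=
    integrable_of_continuous (hdc.mul hpc)
  rw [edist_eq_enorm_sub, momentDeriv, ← integral_sub i1 hgp]
  refine (enorm_integral_le_lintegral_enorm _).trans ?_
  rw [← eLpNorm_one_eq_lintegral_enorm]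
  have h := eLpNorm_smul_le_mul_eLpNorm (p := 2) (q := 2) (r := 1) (μ := surf)
    hpc.aestronglyMeasurable (hdc.aestronglyMeasurable.sub hg.aestronglyMeasurable)
  refine le_trans (le_of_eq ?_) h
  congr 1
  ext σ
  simp [sub_mul]

theorem hardWave_sphere (hR : 0 < R) (σ : S2) :
    hardWave k R (R • (σ : E3)) = (R : ℂ) / (Complex.I * k * R - 1) := by
  have hR' : (R : ℂ) ≠ 0 := by exact_mod_cast hR.ne'
  have h1 : Complex.I * k * R - 1 ≠ 0 := by
    intro h
    have := congrArg Complex.re h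
    simp at this
  have h2 := Complex.exp_ne_zero (Complex.I * k * R)
  rw [hardWave, norm_smul_sphere hR.le]
  field_simp

/-- The coefficients of the boundary data in terms of those of the scattering amplitude. -/
theorem norm_moment_data (hk : 0 < k) (hR : 0 < R) {d : S2 → ℝ}
    (hd : MemLp (fun σ => (d σ : ℂ)) 2 surf)
    (hv : SolvesLinearizedHard k R d v) {A : S2 → ℂ} (hA : IsScatteringAmplitude k v A) {n : ℕ}
    {P : MvPolynomial (Fin 3) ℂ} (hP : IsSolidHarmonic n P) :
    ‖∫ σ, (d σ : ℂ) * polyEval P σ ∂surf‖ =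
      √((k * R) ^ 2 + 1) / R * ‖hankelDeriv n (k * R)‖ * ‖∫ σ, A σ * polyEval P σ ∂surf‖ := by
  set a := ∫ σ, A σ * polyEval P σ ∂surf
  set D := ∫ σ, (d σ : ℂ) * polyEval P σ ∂surf with hD
  set u : ℂ := (R : ℂ) / (Complex.I * k * R - 1) with hu
  have hkR : 0 < k * R := mul_pos hk hR
  have hout := isOutgoing_moment hR.le hv.helmholtz hv.radiating hA hP
  have hH := isOutgoing_hankel hk n
  have hH' : IsOutgoing k R n (fun r => hankel n (k * r)) (fun r => -k * hankel (n + 1) (k * r))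
      ((-Complex.I) ^ n / k) :=
    ⟨⟨fun r hr => hH.hasDerivAt_fst r (hR.trans hr), fun r hr => hH.hasDerivAt_snd r (hR.trans hr)⟩,
      hH.tendsto_fst, hH.tendsto_snd⟩
  have hk' : (k : ℂ) ≠ 0 := by exact_mod_cast hk.ne'
  set b : ℂ := (-Complex.I) ^ n / k with hb
  have hb0 : b ≠ 0 := by rw [hb]; simp [hk.ne']
  have hrel : ∀ r, R < r → b * momentDeriv v P r = a * (k * hankelDeriv n (k * r)) := by
    intro r hr
    have hr' : (r : ℂ) ≠ 0 := by exact_mod_cast (hR.trans hr).ne'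
    obtain ⟨h1, h2⟩ := hout.proportional hk.ne' hR.le hH' hb0 hr
    have e : (k : ℂ) * hankelDeriv n (k * r) =
        -k * hankel (n + 1) (k * r) + n / r * hankel n (k * r) := by
      rw [hankelDeriv]; push_cast; field_simp; ring
    rw [e]
    linear_combination h2 + n / r * h1
  have hcont : Tendsto (fun r : ℝ => a * (k * hankelDeriv n (k * r))) (𝓝[>] R)
      (𝓝 (a * (k * hankelDeriv n (k * R)))) := by
    have hc : ContinuousAt (hankelDeriv n) (k * R) := by
      have h1 := (hasDerivAt_hankel n hkR).continuousAt
      have h2 := (hasDerivAt_hankel (n + 1) hkR).continuousAt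
      refine ContinuousAt.sub (ContinuousAt.mul ?_ h1) h2
      exact continuousAt_const.div Complex.continuous_ofReal.continuousAt
        (by exact_mod_cast hkR.ne')
    have hc2 : ContinuousAt (fun r : ℝ => hankelDeriv n (k * r)) R :=
      ContinuousAt.comp (f := fun r : ℝ => k * r) hc (by fun_prop)
    exact ((hc2.tendsto.const_mul _).const_mul _).mono_left nhdsWithin_le_nhds
  have hg : MemLp (fun σ : S2 => (k : ℂ) ^ 2 * hardWave k R (R • (σ : E3)) * (d σ : ℂ)) 2 surf := by
    simp only [hardWave_sphere hR]
    exact hd.const_mul _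
  have hlim := (tendsto_momentDeriv hR.le hv.helmholtz.1 hg hv.neumann P).const_mul b
  have heq := tendsto_nhds_unique (hlim.congr' (by
    filter_upwards [self_mem_nhdsWithin] with r hr using hrel r hr)) hcont
  have hdata : ∀ σ : S2, (k : ℂ) ^ 2 * hardWave k R (R • (σ : E3)) * (d σ : ℂ) * polyEval P σ =
      (k : ℂ) ^ 2 * u * ((d σ : ℂ) * polyEval P σ) := by
    intro σ; rw [hardWave_sphere hR]; ring
  simp only [hdata] at heq
  rw [integral_const_mul] at heq
  have hn := congrArg norm heq
  have hu' : ‖u‖ = R / √((k * R) ^ 2 + 1) := by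
    rw [hu, norm_div, Complex.norm_real, Real.norm_of_nonneg hR.le]
    congr 1
    rw [Complex.norm_eq_sqrt_sq_add_sq]
    simp
    ring_nf
  have hs : 0 < √((k * R) ^ 2 + 1) := by positivity
  simp only [norm_mul] at hn
  rw [← hD] at hn
  rw [hu', hb] at hn
  simp only [norm_div, norm_pow, norm_neg, Complex.norm_I, one_pow, Complex.norm_real,
    Real.norm_of_nonneg hk.le] at hn
  field_simp at hn ⊢
  linarith

end FarField

theorem IsSolidHarmonic.conj {n : ℕ} {P : MvPolynomial (Fin 3) ℂ} (hP : IsSolidHarmonic n P) :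
    IsSolidHarmonic n (MvPolynomial.map (starRingEnd ℂ) P) := by
  refine ⟨hP.1.map _, ?_⟩
  have h := congrArg (MvPolynomial.map (starRingEnd ℂ)) hP.2
  simpa [MvPolynomial.pderiv_map] using h

theorem polyEval_conj (P : MvPolynomial (Fin 3) ℂ) (x : E3) :
    polyEval (MvPolynomial.map (starRingEnd ℂ) P) x = starRingEnd ℂ (polyEval P x) := by
  induction P using MvPolynomial.induction_on with
  | C a => simp [polyEval]
  | add p q hp hq => simp only [polyEval, map_add] at *; rw [hp, hq]
  | mul_X p j hp => simp only [polyEval, map_mul] at *; rw [hp]; simp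

theorem solvesHelmholtz_polyEval {n : ℕ} {P : MvPolynomial (Fin 3) ℂ} (hP : IsSolidHarmonic n P) :
    SolvesHelmholtz 0 0 (polyEval P) := by
  refine ⟨(contDiff_polyEval P).contDiffOn, fun x _ => ?_⟩
  rw [laplacian_eq_sum_fderiv (contDiff_polyEval P).contDiffAt]
  have h : ∀ i, (fun y => fderiv ℝ (polyEval P) y (basisVec i)) =
      polyEval (MvPolynomial.pderiv i P) := fun i =>
    funext fun y => fderiv_polyEval_single P y i
  have h' : ∀ i, fderiv ℝ (polyEval (MvPolynomial.pderiv i P)) x (basisVec i) =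
      polyEval (MvPolynomial.pderiv i (MvPolynomial.pderiv i P)) x := fun i =>
    fderiv_polyEval_single _ x i
  simp only [h, h', sum_polyEval_pderiv_pderiv hP]
  simp

/-- Solid harmonics of different degrees are orthogonal on the unit sphere. -/
theorem integral_polyEval_mul_eq_zero {m n : ℕ} (hmn : m ≠ n) {P Q : MvPolynomial (Fin 3) ℂ}
    (hP : IsSolidHarmonic n P) (hQ : IsSolidHarmonic m Q) :
    ∫ σ : S2, polyEval Q σ * polyEval P σ ∂surf = 0 := by
  set c := ∫ σ : S2, polyEval Q σ * polyEval P σ ∂surf with hc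
  have hv := solvesHelmholtz_polyEval hQ
  have hm : ∀ r : ℝ, moment (polyEval Q) P r = (r : ℂ) ^ m * c := by
    intro r
    rw [moment, hc, ← integral_const_mul]
    refine integral_congr_ae (Eventually.of_forall fun σ => ?_)
    simp only [polyEval_smul hQ.1]
    ring
  have hmd : ∀ r : ℝ, 0 < r → momentDeriv (polyEval Q) P r = m * (r : ℂ) ^ (m - 1) * c := by
    intro r hr
    refine (hasDerivAt_moment le_rfl hv.1 P hr).unique ?_
    have h1 : HasDerivAt (fun s : ℝ => (s : ℂ) ^ m * c) (m * (r : ℂ) ^ (m - 1) * c) r := by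
      simpa using ((hasDerivAt_pow m (r : ℂ)).comp_ofReal).mul_const c
    exact h1.congr_of_eventuallyEq (Eventually.of_forall hm)
  have hd := hasDerivAt_radial_moment le_rfl hv hP (r := 1) one_pos
  have hq : ∀ r : ℝ, 0 < r → momentDeriv (polyEval Q) P r - n / r * moment (polyEval Q) P r =
      ((m : ℂ) - n) * c * ((r : ℂ) ^ m / r) := by
    intro r hr
    have hr' : (r : ℂ) ≠ 0 := by exact_mod_cast hr.ne'
    rw [hmd r hr, hm]
    rcases m with _ | m
    · simp; ring
    · simp only [Nat.add_sub_cancel]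
      field_simp
      ring
  rw [hq 1 one_pos] at hd
  have hid : HasDerivAt (fun t : ℝ => (t : ℂ)) 1 1 := by
    simpa using (hasDerivAt_id ((1 : ℝ) : ℂ)).comp_ofReal
  have hpow : HasDerivAt (fun s : ℝ => (s : ℂ) ^ m) (m : ℂ) 1 := by
    simpa using (hasDerivAt_pow m ((1 : ℝ) : ℂ)).comp_ofReal
  have hd2 := ((hpow.div hid (by simp)).const_mul (((m : ℂ) - n) * c))
  have hd3 := hd2.congr_of_eventuallyEq (f₁ := fun s : ℝ =>
    momentDeriv (polyEval Q) P s - n / s * moment (polyEval Q) P s) (by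
      filter_upwards [Ioi_mem_nhds one_pos] with s hs using hq s hs)
  have h := hd.unique hd3
  simp at h
  have h2 : ((m : ℂ) - n) * ((m + n + 1 : ℕ) : ℂ) * c = 0 := by
    push_cast
    linear_combination -h
  have h3 : (m : ℂ) - n ≠ 0 := sub_ne_zero.2 (by exact_mod_cast hmn)
  have h4 : ((m + n + 1 : ℕ) : ℂ) ≠ 0 := Nat.cast_ne_zero.2 (by omega)
  exact (mul_eq_zero.1 h2).resolve_left (mul_ne_zero h3 h4)

section Coefficients

variable {ι : ℕ → Type*} [∀ n, Fintype (ι n)] (Y : HarmonicBasis ι)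

theorem exists_polyEval_of_basis (n : ℕ) (m : ι n) :
    ∃ P, IsSolidHarmonic n P ∧ ((Y n m : Lp ℂ 2 surf) : S2 → ℂ) =ᵐ[surf] restrict P :=
  (Y n m).2

theorem exists_coeff_eq_integral (n : ℕ) (m : ι n) :
    ∃ P, IsSolidHarmonic n P ∧ ∀ f : S2 → ℂ,
      coeff Y f n m = ∫ σ : S2, f σ * polyEval P σ ∂surf := by
  obtain ⟨P, hP, hY⟩ := exists_polyEval_of_basis Y n m
  refine ⟨_, hP.conj, fun f => integral_congr_ae ?_⟩
  filter_upwards [hY] with σ hσ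
  rw [hσ, restrict_eq, polyEval_conj]

theorem orthonormal_sigma :
    Orthonormal ℂ fun p : Σ n, ι n => (Y p.1 p.2 : Lp ℂ 2 surf) := by
  constructor
  · rintro ⟨n, m⟩
    exact (Y n).orthonormal.1 m
  · rintro ⟨n, m⟩ ⟨n', m'⟩ hne
    by_cases hn : n = n'
    · subst hn
      have hm : m ≠ m' := fun h => hne (by rw [h])
      exact (Y n).orthonormal.2 hm
    · obtain ⟨P, hP, hY⟩ := exists_polyEval_of_basis Y n m
      obtain ⟨Q, hQ, hY'⟩ := exists_polyEval_of_basis Y n' m'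
      change inner ℂ (Y n m : Lp ℂ 2 surf) (Y n' m' : Lp ℂ 2 surf) = 0
      rw [L2.inner_def, ← integral_polyEval_mul_eq_zero (Ne.symm hn) hP.conj hQ]
      refine integral_congr_ae ?_
      filter_upwards [hY, hY'] with σ h1 h2
      rw [h1, h2, restrict_eq, restrict_eq, polyEval_conj, RCLike.inner_apply]

theorem coeff_eq_inner {f : S2 → ℂ} (hf : MemLp f 2 surf) (n : ℕ) (m : ι n) :
    coeff Y f n m = inner ℂ (Y n m : Lp ℂ 2 surf) (hf.toLp f) := by
  rw [L2.inner_def, coeff]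
  refine integral_congr_ae ?_
  filter_upwards [hf.coeFn_toLp] with σ h
  rw [h, RCLike.inner_apply]

theorem coeffSq_nonneg (f : S2 → ℂ) (n : ℕ) : 0 ≤ coeffSq Y f n :=
  Finset.sum_nonneg fun _ _ => by positivity

/-- Bessel's inequality for spherical harmonics, as a summability statement. -/
theorem summable_coeffSq {f : S2 → ℂ} (hf : MemLp f 2 surf) : Summable (coeffSq Y f) := by
  have h := ((orthonormal_sigma Y).inner_products_summable (hf.toLp f)).sigma
  simp only [tsum_fintype, ← coeff_eq_inner Y hf] at h
  exact h

theorem coeffSq_data {k R : ℝ} {v : E3 → ℂ} (hk : 0 < k) (hR : 0 < R) {d : S2 → ℝ}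
    (hd : MemLp (fun σ => (d σ : ℂ)) 2 surf)
    (hv : SolvesLinearizedHard k R d v) {A : S2 → ℂ} (hA : IsScatteringAmplitude k v A) (n : ℕ) :
    R ^ 2 * coeffSq Y (fun σ => (d σ : ℂ)) n =
      ((k * R) ^ 2 + 1) * ‖hankelDeriv n (k * R)‖ ^ 2 * coeffSq Y A n := by
  rw [coeffSq, coeffSq, Finset.mul_sum, Finset.mul_sum]
  refine Finset.sum_congr rfl fun m _ => ?_
  obtain ⟨P, hP, hc⟩ := exists_coeff_eq_integral Y n m
  rw [hc, hc, norm_moment_data hk hR hd hv hA hP, mul_pow, mul_pow, div_pow,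
    Real.sq_sqrt (by positivity)]
  field_simp

end Coefficients

theorem norm_mul_hankelDeriv_succ_le (m : ℕ) {z : ℝ} (hz : 0 < z) :
    z * ‖hankelDeriv (m + 1) z‖ ≤ Real.exp (m * (m + 1) / (2 * z)) +
      (m + 2) / z * Real.exp ((m + 1) * (m + 2) / (2 * z)) := by
  have h0 := norm_mul_hankel_le m hz
  have h1 := norm_mul_hankel_le (m + 1) hz
  rw [show ((m + 1 : ℕ) : ℝ) * ((m + 1 : ℕ) + 1) = (m + 1) * (m + 2) by push_cast; ring] at h1
  have hn : ‖((m : ℂ) + 2) / z‖ = (m + 2) / z := by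
    rw [show ((m : ℂ) + 2) / z = (((m + 2) / z : ℝ) : ℂ) by push_cast; ring, Complex.norm_real,
      Real.norm_of_nonneg (by positivity)]
  rw [hankelDeriv_succ m hz]
  calc z * ‖hankel m z - (m + 2) / z * hankel (m + 1) z‖
      ≤ z * (‖hankel m z‖ + (m + 2) / z * ‖hankel (m + 1) z‖) := by
        gcongr
        refine (norm_sub_le _ _).trans (le_of_eq ?_)
        rw [norm_mul, hn]
    _ = z * ‖hankel m z‖ + (m + 2) / z * (z * ‖hankel (m + 1) z‖) := by ring
    _ ≤ _ := by gcongr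

theorem norm_mul_hankelDeriv_le_exp {n : ℕ} (hn : 1 ≤ n) {z : ℝ} (hz : 0 < z) :
    z * ‖hankelDeriv n z‖ ≤ Real.exp ((n + 1) ^ 2 / z) := by
  obtain ⟨m, rfl⟩ := Nat.exists_eq_add_of_le' hn
  refine (norm_mul_hankelDeriv_succ_le m hz).trans ?_
  have h1 : Real.exp (m * (m + 1) / (2 * z)) ≤ Real.exp ((m + 1) * (m + 2) / (2 * z)) := by
    gcongr <;> linarith
  have h2 := Real.add_one_le_exp (((m : ℝ) + 2) / z)
  calc _ ≤ Real.exp ((m + 1) * (m + 2) / (2 * z)) +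
        (m + 2) / z * Real.exp ((m + 1) * (m + 2) / (2 * z)) := by gcongr
    _ = Real.exp ((m + 1) * (m + 2) / (2 * z)) * ((m + 2) / z + 1) := by ring
    _ ≤ Real.exp ((m + 1) * (m + 2) / (2 * z)) * Real.exp ((m + 2) / z) := by gcongr
    _ = Real.exp ((m + 2) * (m + 3) / (2 * z)) := by
        rw [← Real.exp_add]; congr 1; field_simp; ring
    _ ≤ _ := by
        refine Real.exp_le_exp.2 ?_
        push_cast
        rw [div_le_div_iff₀ (by positivity) hz]
        have : (0 : ℝ) ≤ m := Nat.cast_nonneg m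
        nlinarith [mul_nonneg (mul_nonneg this this) hz.le, mul_nonneg this hz.le]

theorem twelve_le_const : 12 ≤ Real.exp 1 ^ 2 / Real.pi * (3 + √5) := by
  have h1 : (2.236 : ℝ) ≤ √5 := Real.le_sqrt_of_sq_le (by norm_num)
  have h2 : (2.718 : ℝ) ≤ Real.exp 1 := by linarith [Real.exp_one_gt_d9]
  have h3 : Real.pi ≤ 3.15 := Real.pi_lt_d2.le
  have h4 : (2.718 : ℝ) ^ 2 ≤ Real.exp 1 ^ 2 := by gcongr
  have hpi := Real.pi_pos
  calc (12 : ℝ) ≤ 2.718 ^ 2 / 3.15 * (3 + 2.236) := by norm_num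
    _ ≤ _ := by gcongr

theorem sq_mul_hankelDeriv_le {n : ℕ} {z : ℝ} (hz : 2 ≤ z) (hn : (n : ℝ) ^ 2 ≤ z) :
    z ^ 2 * ‖hankelDeriv n z‖ ^ 2 ≤ Real.exp 1 ^ 2 / Real.pi * (3 + √5) := by
  have hz0 : 0 < z := by linarith
  refine le_trans ?_ twelve_le_const
  have e1 : Real.exp (1 / 2) ≤ 1.65 := by
    refine le_of_sq_le_sq ?_ (by norm_num)
    rw [← Real.exp_nat_mul]
    norm_num
    linarith [Real.exp_one_lt_d9]
  have e3 : Real.exp (3 / 4) ≤ 2.12 := by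
    refine le_of_pow_le_pow_left₀ (n := 4) (by norm_num) (by norm_num) ?_
    have h : Real.exp (3 / 4) ^ 4 = Real.exp 1 ^ 3 := by
      rw [← Real.exp_nat_mul, ← Real.exp_nat_mul]; norm_num
    rw [h]
    calc Real.exp 1 ^ 3 ≤ 2.719 ^ 3 := by
          gcongr; linarith [Real.exp_one_lt_d9]
      _ ≤ _ := by norm_num
  have key : z * ‖hankelDeriv n z‖ ≤ 3.4 := by
    match n, hn with
    | 0, _ =>
      have h1 := norm_mul_hankel_le 1 hz0
      have h2 : ‖hankelDeriv 0 z‖ = ‖hankel 1 z‖ := by simp [hankelDeriv]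
      rw [h2]
      refine h1.trans (le_trans (Real.exp_le_exp.2 ?_) (e1.trans (by norm_num)))
      rw [div_le_div_iff₀ (by positivity) (by norm_num)]
      push_cast; linarith
    | 1, _ =>
      have h := norm_mul_hankelDeriv_succ_le 0 hz0
      have h1 : Real.exp (((0 : ℕ) + 1) * ((0 : ℕ) + 2) / (2 * z)) ≤ Real.exp (1 / 2) := by
        refine Real.exp_le_exp.2 ?_
        rw [div_le_div_iff₀ (by positivity) (by norm_num)]
        push_cast; linarith
      have h2 : (((0 : ℕ) : ℝ) + 2) / z ≤ 1 := by
        rw [div_le_one hz0]; push_cast; linarith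
      have h3 := mul_le_mul h2 (h1.trans e1) (Real.exp_pos _).le zero_le_one
      simp only [Nat.cast_zero, zero_mul, zero_div, Real.exp_zero, zero_add] at h h3 ⊢
      linarith
    | m + 2, hn =>
      have h := norm_mul_hankelDeriv_succ_le (m + 1) hz0
      have hm : (0 : ℝ) ≤ m := Nat.cast_nonneg m
      push_cast at h hn
      have h1 : Real.exp (((m : ℝ) + 1) * (m + 1 + 1) / (2 * z)) ≤ Real.exp (1 / 2) := by
        refine Real.exp_le_exp.2 ?_
        rw [div_le_div_iff₀ (by positivity) (by norm_num)]
        nlinarith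
      have h2 : Real.exp (((m : ℝ) + 1 + 1) * (m + 1 + 2) / (2 * z)) ≤ Real.exp (3 / 4) := by
        refine Real.exp_le_exp.2 ?_
        rw [div_le_div_iff₀ (by positivity) (by norm_num)]
        nlinarith
      have h3 : ((m : ℝ) + 1 + 2) / z ≤ 3 / 4 := by
        rw [div_le_div_iff₀ (by positivity) (by norm_num)]
        nlinarith
      have h4 := mul_le_mul h3 (h2.trans e3) (Real.exp_pos _).le (by norm_num)
      have h5 := h1.trans e1
      norm_num at h4 h5 ⊢
      linarith
  calc z ^ 2 * ‖hankelDeriv n z‖ ^ 2 = (z * ‖hankelDeriv n z‖) ^ 2 := by ring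
    _ ≤ 3.4 ^ 2 := by gcongr
    _ ≤ 12 := by norm_num

theorem sq_mul_hankelDeriv_le_exp {n : ℕ} (hn : 1 ≤ n) {k R E : ℝ} (hk : 0 < k) (hR : 0 < R)
    (hkR : 2 ≤ k * R) (hE : 0 ≤ E) (hnE : ((n : ℝ) + 1) ^ 2 ≤ E + k) :
    (k * R) ^ 2 * ‖hankelDeriv n (k * R)‖ ^ 2 ≤ Real.exp (2 / R) * Real.exp E := by
  have hz : 0 < k * R := by linarith
  have h1 : ((n : ℝ) + 1) ^ 2 / (k * R) ≤ E / 2 + 1 / R := by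
    calc ((n : ℝ) + 1) ^ 2 / (k * R) ≤ (E + k) / (k * R) := by gcongr
      _ = E / (k * R) + 1 / R := by field_simp
      _ ≤ E / 2 + 1 / R := by gcongr
  calc (k * R) ^ 2 * ‖hankelDeriv n (k * R)‖ ^ 2 = (k * R * ‖hankelDeriv n (k * R)‖) ^ 2 := by ring
    _ ≤ Real.exp (E / 2 + 1 / R) ^ 2 := by
        gcongr
        exact (norm_mul_hankelDeriv_le_exp hn hz).trans (Real.exp_le_exp.2 h1)
    _ = _ := by
        rw [← Real.exp_nat_mul, ← Real.exp_add]
        congr 1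
        push_cast
        ring

theorem sq_le_of_le_cutoff {n : ℕ} {k R : ℝ} (hkR : 0 ≤ k * R) (hn : n ≤ cutoff k R) :
    (n : ℝ) ^ 2 ≤ k * R := by
  have h : (n : ℝ) ≤ √(k * R) := (Nat.cast_le.2 hn).trans (Nat.floor_le (Real.sqrt_nonneg _))
  calc (n : ℝ) ^ 2 ≤ √(k * R) ^ 2 := by gcongr
    _ = k * R := Real.sq_sqrt hkR

/-- The stability estimate, for sequences related as the squared coefficients of the boundary data
and of the scattering amplitude are. -/
theorem tsum_le_of_relation {k R : ℝ} (hk : 0 < k) (hR : 0 < R) (hkR : 2 ≤ k * R)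
    {a D S : ℕ → ℝ} (ha0 : ∀ n, 0 ≤ a n) (hD0 : ∀ n, 0 ≤ D n) (haS : Summable a)
    (hDS : Summable D) {c K T : ℝ} (hc0 : 0 < c)
    (hK : K = Real.exp 1 ^ 2 / Real.pi * (3 + √5))
    (hrel : ∀ n, R ^ 2 * D n = c * ((k * R) ^ 2 * ‖hankelDeriv n (k * R)‖ ^ 2 * a n))
    (hSdef : ∀ n, S n = R ^ 2 * (D n + ((n : ℝ) / R) ^ 2 * D n)) (hS : HasSum S T)
    {N : ℕ} (hN : ∀ n ≤ N, (n : ℝ) ^ 2 ≤ k * R) {ε₁ ε₂ E : ℝ}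
    (hε₁sq : ε₁ ^ 2 = ∑ n ∈ Finset.range (N + 1), a n)
    (hε₂sq : ε₂ ^ 2 = ∑' n, a (n + (N + 1))) (hε₂_le : ε₂ ≤ 1) (hE : E = -Real.log ε₂) :
    (0 < ε₂ → E + k ≠ 1 →
      ∑' n, R ^ 2 * D n ≤ c * (K * ε₁ ^ 2 + Real.exp (2 / R) * ε₂) +
        R ^ 2 * T / (E + k - 2 * √(E + k) + 1)) ∧
    (ε₂ = 0 → ∑' n, R ^ 2 * D n ≤ c * (K * ε₁ ^ 2)) := by
  have hz : 0 < k * R := by linarith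
  have hlow : ∑ n ∈ Finset.range (N + 1), R ^ 2 * D n ≤ c * (K * ε₁ ^ 2) := by
    rw [hε₁sq, Finset.mul_sum, Finset.mul_sum]
    refine Finset.sum_le_sum fun n hn => ?_
    rw [hrel n, hK]
    have := sq_mul_hankelDeriv_le hkR
      (hN n (Nat.lt_succ_iff.1 (Finset.mem_range.1 hn)))
    have := ha0 n
    gcongr
  have hsplit : ∑' n, R ^ 2 * D n =
      ∑ n ∈ Finset.range (N + 1), R ^ 2 * D n + ∑' n, R ^ 2 * D (n + (N + 1)) :=
    ((hDS.mul_left (R ^ 2)).sum_add_tsum_nat_add (N + 1)).symm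
  have haS' : Summable fun n => a (n + (N + 1)) := (summable_nat_add_iff (N + 1)).2 haS
  have hDS' : Summable fun n => R ^ 2 * D (n + (N + 1)) :=
    (summable_nat_add_iff (N + 1)).2 (hDS.mul_left (R ^ 2))
  constructor
  · intro hpos hne
    have hE0 : 0 ≤ E := by
      rw [hE, neg_nonneg]; exact Real.log_nonpos hpos.le hε₂_le
    have hexpE : Real.exp E = ε₂⁻¹ := by rw [hE, Real.exp_neg, Real.exp_log hpos]
    have hEk : 0 ≤ E + k := by linarith
    set s := √(E + k) with hs
    have hs0 : 0 ≤ s := Real.sqrt_nonneg _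
    have hs2 : s ^ 2 = E + k := Real.sq_sqrt hEk
    have hden : E + k - 2 * s + 1 = (s - 1) ^ 2 := by rw [← hs2]; ring
    have hs1 : s - 1 ≠ 0 := by
      intro h
      apply hne
      rw [← hs2, sub_eq_zero.1 h, one_pow]
    have hden0 : 0 < (s - 1) ^ 2 := by positivity
    rw [hden]
    have hS0 : ∀ n, 0 ≤ S n := fun n => by have := hD0 n; rw [hSdef]; positivity
    have hS' : Summable fun n => S (n + (N + 1)) := (summable_nat_add_iff (N + 1)).2 hS.summable
    have hterm : ∀ n, R ^ 2 * D (n + (N + 1)) ≤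
        c * (Real.exp (2 / R) * ε₂⁻¹) * a (n + (N + 1)) +
          R ^ 2 / (s - 1) ^ 2 * S (n + (N + 1)) := by
      intro n
      set p := n + (N + 1) with hp
      have hp1 : 1 ≤ p := by omega
      have hp1' : (1 : ℝ) ≤ p := by exact_mod_cast hp1
      have hap := ha0 p
      have hSp := hS0 p
      have hDp := hD0 p
      by_cases hcase : ((p : ℝ) + 1) ^ 2 ≤ E + k
      · have h1 := sq_mul_hankelDeriv_le_exp hp1 hk hR hkR hE0 hcase
        rw [hexpE] at h1
        have h2 : R ^ 2 * D p ≤ c * (Real.exp (2 / R) * ε₂⁻¹) * a p := by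
          rw [hrel p, mul_assoc c]
          gcongr
        have h3 : 0 ≤ R ^ 2 / (s - 1) ^ 2 * S p := by positivity
        linarith
      · have hsp : s < p + 1 := by
          rw [hs, Real.sqrt_lt' (by positivity)]
          exact not_le.1 hcase
        have h1 : (s - 1) ^ 2 ≤ (p : ℝ) ^ 2 + R ^ 2 :=
          (sq_le_sq' (by linarith) (by linarith)).trans (le_add_of_nonneg_right (sq_nonneg R))
        have h2 : R ^ 2 * D p ≤ R ^ 2 / (s - 1) ^ 2 * S p := by
          have e : R ^ 2 / (s - 1) ^ 2 * S p =
              R ^ 2 * D p * (((p : ℝ) ^ 2 + R ^ 2) / (s - 1) ^ 2) := by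
            rw [hSdef]; field_simp; ring
          rw [e]
          exact le_mul_of_one_le_right (by positivity) ((one_le_div hden0).2 h1)
        have h3 : 0 ≤ c * (Real.exp (2 / R) * ε₂⁻¹) * a p := by positivity
        linarith
    have hhigh : ∑' n, R ^ 2 * D (n + (N + 1)) ≤
        c * (Real.exp (2 / R) * ε₂) + R ^ 2 * T / (s - 1) ^ 2 := by
      refine (hDS'.tsum_le_tsum hterm ((haS'.mul_left _).add (hS'.mul_left _))).trans ?_
      rw [(haS'.mul_left _).tsum_add (hS'.mul_left _), tsum_mul_left, tsum_mul_left, ← hε₂sq]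
      have e1 : c * (Real.exp (2 / R) * ε₂⁻¹) * ε₂ ^ 2 = c * (Real.exp (2 / R) * ε₂) := by
        field_simp
      have h1 : ∑' n, S (n + (N + 1)) ≤ T := by
        rw [← hS.tsum_eq, ← hS.summable.sum_add_tsum_nat_add (N + 1)]
        exact le_add_of_nonneg_left (Finset.sum_nonneg fun n _ => hS0 n)
      rw [e1, mul_div_right_comm]
      gcongr
    rw [hsplit]
    linarith
  · intro h0
    have htail : ∑' n, a (n + (N + 1)) = 0 := by rw [← hε₂sq, h0]; norm_num
    have hz0 : ∀ n, a (n + (N + 1)) = 0 := fun n =>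
      congrFun ((hasSum_zero_iff_of_nonneg fun n => ha0 (n + (N + 1))).1
        (htail ▸ haS'.hasSum)) n
    have hDz : ∀ n, R ^ 2 * D (n + (N + 1)) = 0 := fun n => by rw [hrel, hz0]; ring
    rw [hsplit]
    simp only [hDz, tsum_zero, add_zero]
    exact hlow

section Estimate

variable {ι : ℕ → Type*} [∀ n, Fintype (ι n)] (Y : HarmonicBasis ι)

theorem sobolevSq_zero {R : ℝ} {f : S2 → ℂ} :
    sobolevSq Y R 0 f = ∑' n, R ^ 2 * coeffSq Y f n := by
  simp [sobolevSq, tsum_mul_left]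

theorem summable_sobolev_one {R : ℝ} {f : S2 → ℂ} (hf : MemH1 Y f) :
    Summable fun n : ℕ => ((n : ℝ) / R) ^ 2 * coeffSq Y f n := by
  refine (hf.2.mul_left (R ^ 2)⁻¹).congr fun n => ?_
  ring

theorem hasSum_sobolevSq_one {R : ℝ} {f : S2 → ℂ} (hf : MemH1 Y f) :
    HasSum (fun n : ℕ => R ^ 2 * (coeffSq Y f n + ((n : ℝ) / R) ^ 2 * coeffSq Y f n))
      (sobolevSq Y R 1 f) := by
  have h := ((summable_coeffSq Y hf.1).hasSum.add
    (summable_sobolev_one (R := R) Y hf).hasSum).mul_left (R ^ 2)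
  have e : sobolevSq Y R 1 f =
      R ^ 2 * (∑' n, coeffSq Y f n + ∑' n : ℕ, ((n : ℝ) / R) ^ 2 * coeffSq Y f n) := by
    simp [sobolevSq, Finset.sum_range_succ]
  rw [e]
  exact h

end Estimate

end HardObstacle

end

theorem corollary4p2 {ι : ℕ → Type*} [∀ n, Fintype (ι n)] (Y : HardObstacle.HarmonicBasis ι)
    (k R : ℝ) (hk : 0 < k) (hR : 0 < R) (hkR : 2 ≤ k * R)
    (d : HardObstacle.S2 → ℝ) (hd : HardObstacle.MemH1 Y (fun σ => (d σ : ℂ)))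
    (v : HardObstacle.E3 → ℂ) (hv : HardObstacle.SolvesLinearizedHard k R d v)
    (A : HardObstacle.S2 → ℂ) (hA : HardObstacle.IsScatteringAmplitude k v A)
    (ε₁ ε₂ E : ℝ) (hε₁ : ε₁ = HardObstacle.eps1 Y k R A) (hε₂ : ε₂ = HardObstacle.eps2 Y k R A)
    (hε₂_le : ε₂ ≤ 1) (hE : E = -Real.log ε₂) :
    (0 < ε₂ → E + k ≠ 1 →
      HardObstacle.sobolevSq Y R 0 (fun σ => (d σ : ℂ)) ≤
        (k ^ 2 * R ^ 2 + 1) / (k ^ 2 * R ^ 2) *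
            (Real.exp 1 ^ 2 / Real.pi * (3 + √5) * ε₁ ^ 2 + Real.exp (2 / R) * ε₂) +
          R ^ 2 * HardObstacle.sobolevSq Y R 1 (fun σ => (d σ : ℂ)) /
            (E + k - 2 * √(E + k) + 1)) ∧
    (ε₂ = 0 →
      HardObstacle.sobolevSq Y R 0 (fun σ => (d σ : ℂ)) ≤
        (k ^ 2 * R ^ 2 + 1) / (k ^ 2 * R ^ 2) *
          (Real.exp 1 ^ 2 / Real.pi * (3 + √5) * ε₁ ^ 2)) := by
  have hz : 0 < k * R := by linarith
  have hAmem : MemLp A 2 HardObstacle.surf :=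
    (HardObstacle.continuous_scatteringAmplitude hR.le hv.helmholtz hA).memLp_of_hasCompactSupport
      (HasCompactSupport.of_compactSpace _)
  rw [HardObstacle.sobolevSq_zero]
  refine HardObstacle.tsum_le_of_relation (a := HardObstacle.coeffSq Y A)
    (N := HardObstacle.cutoff k R) hk hR hkR (HardObstacle.coeffSq_nonneg Y A)
    (HardObstacle.coeffSq_nonneg Y _) (HardObstacle.summable_coeffSq Y hAmem)
    (HardObstacle.summable_coeffSq Y hd.1) (by positivity) rfl (fun n => ?_) (fun n => rfl)
    (HardObstacle.hasSum_sobolevSq_one Y hd)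
    (fun n hn => HardObstacle.sq_le_of_le_cutoff hz.le hn) ?_ ?_ hε₂_le hE
  · rw [HardObstacle.coeffSq_data Y hk hR hd.1 hv hA n]
    field_simp
  · rw [hε₁, HardObstacle.eps1,
      Real.sq_sqrt (Finset.sum_nonneg fun n _ => HardObstacle.coeffSq_nonneg Y A n)]
  · rw [hε₂, HardObstacle.eps2,
      Real.sq_sqrt (tsum_nonneg fun n => HardObstacle.coeffSq_nonneg Y A _)]
    exact tsum_congr fun n => by rw [add_comm]
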